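/- **Notation.** For $h>0$ and a symbol $a\in S(1)$ (a smooth function on $\mathbb R^2$ with all derivatives bounded) let $$\mathrm{Op}_h(a)f(x)=\frac1{2\pi h}\int_{\mathbb R}\int_{\mathbb R} e^{\frac ih(x-x')\xi}\,a\Big(\frac{x+x'}2,\xi\Big)f(x')\,dx'\,d\xi ,\qquad f\in\mathscr S(\mathbb R),$$ be its Weyl quantization, extended to a bounded operator on $L^2(\mathbb R)$. For $A\in \mathrm{SL}(2,\mathbb R)$ a *metaplectic operator* of $A$ is a unitary operator $M$ of $L^2(\mathbb R)$ with $M^{-1}\mathrm{Op}_h(a)M=\mathrm{Op}_h(a\circ A)$ for all $a\in S(1)$; such an $M$ exists, is unique up to a unit factor, and extends uniquely to a continuous operator of $\mathscr S'(\mathbb R)$, also denoted $M$. For $N\in\mathbb N$, $N\ge 1$, put $h=(2\pi N)^{-1}$, let $U_{\omega}f(x)=e^{\frac ih\eta x-\frac i{2h}y\eta}f(x-y)$ for $\omega=(y,\eta)$, and let $$\mathcal H_N(0)=\{f\in\mathscr S'(\mathbb R):\ U_{\omega}f=e^{N\pi i\,y\eta}f\ \text{ for all }\omega=(y,\eta)\in\mathbb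 Z^2\}.$$ This space is $N$-dimensional with basis $e_j=\frac1{\sqrt N}\sum_{k\in\mathbb Z}\delta\big(x-\frac{Nk+j}{N}\big)$, $0\le j\le N-1$; for $u=\sum_j c_je_j$ put $\|u\|_{\ell^2}=(\sum_j|c_j|^2)^{1/2}$ and $\|u\|_{\ell^\infty}=\max_j|c_j|$. If $A=\begin{pmatrix}a&b\\c&d\end{pmatrix}\in\mathrm{SL}(2,\mathbb Z)$ with $ab$ and $cd$ even, then $M$ maps $\mathcal H_N(0)$ to itself, and the *quantum cat map* $M_{N,0}$ is the restriction of $M$ (for $h=(2\pi N)^{-1}$) to $\mathcal H_N(0)$. **Theorem.** Let $A=\begin{pmatrix}a&b\\c&d\end{pmatrix}\in\mathrm{SL}(2,\mathbb Z)$ with $|a+d|>2$ and $ab,cd\in2\mathbb Z$. Suppose that $A$ has positive eigenvalues and even trace and that $b$ and $c$ are coprime, and let $\lambda$ be the largest eigenvalue of $A$. Then there is a sequence of odd integers $N_k\to\infty$ such that for every $\varepsilon>0$ there is a $k_0$ such that for every $k\ge k_0$ there is an eigenfunction $u\in\mathcal H_{N_k}(0)$ of $M_{N_k,0}$ with $\|u\|_{\ell^2}=1$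 and $$\|u\|_{\ell^\infty}\ \ge\ \frac{1-\varepsilon}{\sqrt{2\log_\lambda N_k}} .$$ -/

import Mathlib

open MeasureTheory
open scoped SchwartzMap

noncomputable section

namespace CatMap

/-- The Hilbert space `L²(ℝ)` of complex valued functions. -/
abbrev L2 : Type := Lp ℂ 2 (volume : Measure ℝ)

/-- The symbol class `S(1)`: smooth functions on the phase space `ℝ² = {(x, ξ)}` all of whose
derivatives are bounded. -/
def IsSymbol (a : ℝ × ℝ → ℂ) : Prop :=
  ContDiff ℝ (⊤ : ℕ∞) a ∧ ∀ n : ℕ, ∃ C : ℝ, ∀ z, ‖iteratedFDeriv ℝ n a z‖ ≤ C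

/-- The semiclassical Weyl quantization of a symbol `a`, acting on a Schwartz function `f`:
`(1 / 2πh) ∫∫ exp ((i/h) (x - x') ξ) a ((x + x')/2, ξ) f (x') dx' dξ`.
For `a` in `S(1)` the inner integral (over `x'`) converges absolutely and is rapidly decreasing
in `ξ`, so that the outer one (over `ξ`) converges absolutely as well. -/
def weylOp (h : ℝ) (a : ℝ × ℝ → ℂ) (f : 𝓢(ℝ, ℂ)) (x : ℝ) : ℂ :=
  (1 / (2 * Real.pi * h) : ℝ) *
    ∫ ξ : ℝ, ∫ x' : ℝ,
      Complex.exp (Complex.I * ((x - x') * ξ / h : ℝ)) * a ((x + x') / 2, ξ) * f x'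

/-- `T` is the operator `Op_h(a)` on `L²(ℝ)`: the bounded operator which on the (dense) Schwartz
functions is given by the Weyl quantization formula. There is exactly one such `T` for `a` in
`S(1)`. -/
def IsWeylQuantization (h : ℝ) (a : ℝ × ℝ → ℂ) (T : L2 →L[ℂ] L2) : Prop :=
  ∀ f : 𝓢(ℝ, ℂ), T (f.toLp 2) =ᵐ[volume] weylOp h a f

/-- The linear action of a matrix in `SL(2, ℝ)` on the phase space. -/
def act (A : Matrix.SpecialLinearGroup (Fin 2) ℝ) (z : ℝ × ℝ) : ℝ × ℝ :=
  (A 0 0 * z.1 + A 0 1 * z.2, A 1 0 * z.1 + A 1 1 * z.2)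

/-- `M` is a metaplectic operator associated with `A`: a unitary operator of `L²(ℝ)` with the exact
Egorov property `M⁻¹ Op_h(a) M = Op_h(a ∘ A)` for all `a` in `S(1)`. -/
def IsMetaplectic (h : ℝ) (A : Matrix.SpecialLinearGroup (Fin 2) ℝ) (M : L2 ≃ₗᵢ[ℂ] L2) : Prop :=
  ∀ a : ℝ × ℝ → ℂ, IsSymbol a → ∀ T T' : L2 →L[ℂ] L2,
    IsWeylQuantization h a T → IsWeylQuantization h (a ∘ act A) T' →
      ∀ f : L2, M.symm (T (M f)) = T' f

/-- `T` is the (unique) extension of the operator `M` of `L²(ℝ)` to a continuous linear operator on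
the tempered distributions, with their topology of pointwise convergence on Schwartz functions. -/
def IsTemperedExtension (M : L2 ≃ₗᵢ[ℂ] L2) (T : 𝓢'(ℝ, ℂ) →L[ℂ] 𝓢'(ℝ, ℂ)) : Prop :=
  ∀ f : L2, T (Lp.toTemperedDistribution f) = Lp.toTemperedDistribution (M f)

/-- The plane wave `x ↦ exp (i c x)`. -/
def wave (c : ℝ) (x : ℝ) : ℂ := Complex.exp (Complex.I * (c * x : ℝ))

theorem wave_hasTemperateGrowth (c : ℝ) : (wave c).HasTemperateGrowth := by
  have hd : ∀ n : ℕ, iteratedDeriv n (wave c) =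
      fun x => (Complex.I * c) ^ n * wave c x := by
    intro n
    induction n with
    | zero => simp
    | succ n ih =>
      rw [iteratedDeriv_succ, ih]
      funext x
      have h1 : HasDerivAt (wave c) (wave c x * (Complex.I * c)) x := by
        unfold wave
        refine HasDerivAt.cexp ?_
        have := ((hasDerivAt_id x).const_mul c).ofReal_comp.const_mul Complex.I
        simpa using this
      rw [(h1.const_mul _).deriv]
      ring
  refine ⟨?_, fun n => ⟨0, |c| ^ n, fun x => ?_⟩⟩
  · unfold wave
    have h0 : ContDiff ℝ (⊤ : ℕ∞) fun x : ℝ => ((c * x : ℝ) : ℂ) :=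
      Complex.ofRealCLM.contDiff.comp (contDiff_const.mul contDiff_id)
    exact (contDiff_const.mul h0).cexp
  · rw [norm_iteratedFDeriv_eq_norm_iteratedDeriv, hd]
    simp [wave, Complex.norm_exp]

/-- The quantum translation `U_ω`, `ω = (y, η)`, on Schwartz functions:
`U_ω f (x) = exp ((i/h) η x - (i/2h) y η) f (x - y)`. -/
def translationS (h : ℝ) (ω : ℝ × ℝ) : 𝓢(ℝ, ℂ) →L[ℂ] 𝓢(ℝ, ℂ) :=
  Complex.exp (-Complex.I * (ω.1 * ω.2 / (2 * h) : ℝ)) •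
    (SchwartzMap.smulLeftCLM ℂ (wave (ω.2 / h)) ∘L SchwartzMap.compSubConstCLM ℂ ω.1)

theorem translationS_apply (h : ℝ) (ω : ℝ × ℝ) (f : 𝓢(ℝ, ℂ)) (x : ℝ) :
    translationS h ω f x =
      Complex.exp (Complex.I * (ω.2 * x / h - ω.1 * ω.2 / (2 * h) : ℝ)) * f (x - ω.1) := by
  simp only [translationS, smul_apply, ContinuousLinearMap.comp_apply,
    SchwartzMap.smulLeftCLM_apply_apply (wave_hasTemperateGrowth _),
    SchwartzMap.compSubConstCLM_apply, wave, smul_eq_mul]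
  rw [← mul_assoc, ← Complex.exp_add]
  congr 2
  push_cast
  ring

/-- The quantum translation `U_ω` on tempered distributions, by duality: the transpose of
`U_(y, η)` with respect to the bilinear pairing `∫ f g` is `U_(-y, η)`. -/
def translation (h : ℝ) (ω : ℝ × ℝ) : 𝓢'(ℝ, ℂ) →L[ℂ] 𝓢'(ℝ, ℂ) :=
  PointwiseConvergenceCLM.precomp ℂ (translationS h (-ω.1, ω.2))

/-- On Schwartz functions the two definitions of `U_ω` agree. -/
theorem translation_coe (h : ℝ) (ω : ℝ × ℝ) (f : 𝓢(ℝ, ℂ)) :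
    translation h ω (f : 𝓢'(ℝ, ℂ)) = (translationS h ω f : 𝓢(ℝ, ℂ)) := by
  ext g
  have e : translation h ω (f : 𝓢'(ℝ, ℂ)) g =
      (f : 𝓢'(ℝ, ℂ)) (translationS h (-ω.1, ω.2) g) := rfl
  rw [e]
  simp only [SchwartzMap.toTemperedDistributionCLM_apply_apply, translationS_apply, smul_eq_mul]
  rw [← integral_sub_right_eq_self _ ω.1]
  congr 1
  funext x
  have e2 : x - ω.1 - -ω.1 = x := by ring
  have e3 : ω.2 * (x - ω.1) / h - -ω.1 * ω.2 / (2 * h) =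
      ω.2 * x / h - ω.1 * ω.2 / (2 * h) := by ring
  rw [e2, e3]
  ring

/-- The semiclassical parameter `h = 1 / (2πN)`. -/
def planck (N : ℕ) : ℝ := (2 * Real.pi * N)⁻¹

/-- The space `H_N(0)` of quantum states: the tempered distributions `f` with
`U_ω f = exp (N π i Q(ω)) f`, `Q(y, η) = y η`, for all `ω` in `ℤ²`. -/
def stateSpace (N : ℕ) : Submodule ℂ 𝓢'(ℝ, ℂ) where
  carrier := {u | ∀ y η : ℤ, translation (planck N) ((y : ℝ), (η : ℝ)) u =
    Complex.exp (N * Real.pi * Complex.I * (y * η : ℤ)) • u}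
  add_mem' := by
    intro u v hu hv y η
    rw [map_add, hu y η, hv y η, smul_add]
  zero_mem' := by
    intro y η
    rw [map_zero, smul_zero]
  smul_mem' := by
    intro c u hu y η
    rw [map_smul, hu y η, smul_comm]

theorem summable_comb_weight (s : ℝ) : Summable fun k : ℤ => ((1 + |(k : ℝ) + s|) ^ 2)⁻¹ := by
  have h1 : Summable fun k : ℤ => 1 / |(k : ℝ) + s| ^ (2 : ℝ) :=
    (Real.summable_one_div_int_add_rpow s 2).2 (by norm_num)
  refine Summable.of_norm_bounded_eventually h1 ?_
  have hfin : {k : ℤ | (k : ℝ) + s = 0}.Finite := by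
    refine Set.Subsingleton.finite ?_
    intro a ha b hb
    have h2 : (a : ℝ) = b := by
      simp only [Set.mem_ofPred_eq] at ha hb
      linarith
    exact_mod_cast h2
  filter_upwards [hfin.compl_mem_cofinite] with k hk
  have hpos : 0 < |(k : ℝ) + s| := abs_pos.2 hk
  rw [Real.norm_of_nonneg (by positivity), one_div, Real.rpow_two]
  gcongr
  linarith

theorem norm_apply_le_comb (s : ℝ) (f : 𝓢(ℝ, ℂ)) (k : ℤ) :
    ‖f (k + s)‖ ≤ ((1 + |(k : ℝ) + s|) ^ 2)⁻¹ *
      (4 * (Finset.Iic (2, 0)).sup (schwartzSeminormFamily ℂ ℝ ℂ) f) := by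
  have h1 := SchwartzMap.one_add_le_sup_seminorm_apply (𝕜 := ℂ) (m := (2, 0)) (k := 2) (n := 0)
    le_rfl le_rfl f ((k : ℝ) + s)
  rw [norm_iteratedFDeriv_zero, Real.norm_eq_abs] at h1
  rw [le_inv_mul_iff₀ (by positivity)]
  refine h1.trans (le_of_eq ?_)
  norm_num
  rfl

theorem summable_comb (s : ℝ) (f : 𝓢(ℝ, ℂ)) : Summable fun k : ℤ => f (k + s) :=
  .of_norm_bounded ((summable_comb_weight s).mul_right _) (norm_apply_le_comb s f)

/-- The Dirac comb `∑ k, δ (x - (k + s))`, summed over the integers `k`. -/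
def comb (s : ℝ) : 𝓢'(ℝ, ℂ) :=
  ContinuousLinearMap.toPointwiseConvergenceCLM _ _ _ _ <|
  SchwartzMap.mkCLMtoNormedSpace (𝕜 := ℂ) (σ := RingHom.id ℂ)
    (fun f : 𝓢(ℝ, ℂ) => ∑' k : ℤ, f (k + s))
    (fun f g => by
      simpa using (summable_comb s f).tsum_add (summable_comb s g))
    (fun c f => by
      simpa using tsum_mul_left)
    ⟨Finset.Iic (2, 0), (∑' k : ℤ, ((1 + |(k : ℝ) + s|) ^ 2)⁻¹) * 4, by positivity, fun f => by
      rw [mul_assoc, ← tsum_mul_right]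
      exact tsum_of_norm_bounded ((summable_comb_weight s).mul_right _).hasSum
        (norm_apply_le_comb s f)⟩

theorem comb_apply (s : ℝ) (f : 𝓢(ℝ, ℂ)) : comb s f = ∑' k : ℤ, f (k + s) := rfl

/-- The basis vector `e_j = N^(-1/2) ∑ k, δ (x - (N k + j) / N)` of `H_N(0)`. -/
def basisState (N : ℕ) (j : Fin N) : 𝓢'(ℝ, ℂ) :=
  (1 / Real.sqrt N : ℂ) • comb ((j : ℝ) / N)

/-- `c` is the coordinate vector of `u` in the basis `e_0, …, e_(N-1)`. The norms `‖u‖_ℓ²` and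
`‖u‖_ℓ^∞` of a state `u` are those of its coordinate vector. -/
def HasCoordinates (N : ℕ) (u : 𝓢'(ℝ, ℂ)) (c : Fin N → ℂ) : Prop :=
  u = ∑ j, c j • basisState N j

/-- The operator of `L²(ℝ)` and its extension to tempered distributions that define the quantum
cat map `M_{N,0}` of `A`. The map `M_{N,0}` itself is the restriction of `T` to `H_N(0)`. -/
structure IsQuantization (N : ℕ) (A : Matrix.SpecialLinearGroup (Fin 2) ℤ)
    (M : L2 ≃ₗᵢ[ℂ] L2) (T : 𝓢'(ℝ, ℂ) →L[ℂ] 𝓢'(ℝ, ℂ)) : Prop where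
  metaplectic : IsMetaplectic (planck N)
    (Matrix.SpecialLinearGroup.map (Int.castRingHom ℝ) A) M
  extension : IsTemperedExtension M T

/-- The real eigenvalues of an integer matrix of determinant one. -/
def realEigenvalues (A : Matrix.SpecialLinearGroup (Fin 2) ℤ) : Set ℝ :=
  {μ | Module.End.HasEigenvalue
    (Matrix.toLin' ((A : Matrix (Fin 2) (Fin 2) ℤ).map (Int.cast : ℤ → ℝ))) μ}

end CatMap

end

/-! ### Powers of integer matrices of determinant one -/

/-! Short periods of the quantum map force concentrated eigenfunctions. Write `p` for the Lucas
sequence of the trace `t`, so that `p n = (λ ^ n - λ ^ (-n)) / (λ - λ⁻¹)`. Since `A ^ m - A ^ (-m) =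
p m * (A - A⁻¹)` and `A - A⁻¹ = 2 * (A - t / 2)` for even `t`, the power `A ^ (2 * m)` is the
identity modulo `2 * p m`. Take `N = p (2 * k + 1)`. It is odd, at least `λ ^ (2 * k)`, and `A ^ n ≡
1` modulo `2 * N` with `n = 2 * (2 * k + 1)`, so `n` is at most about `2 * log_λ N`.

The exact Egorov property, applied to exponential symbols, says that the quantum map carries `U_ω`
to `U_(Aω)`. On `H_N(0)` the operators `U_(m/N, n/N)` depend on `(m, n)` modulo `2 * N` only, so the
`n`-th power of the quantum map commutes with all of them and is a scalar by Schur's lemma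
(`exists_inner_eq_mul_inner`). The spectral decomposition of `e_0` then has at most `n` components,
and one of them, normalized, has inner product at least `1 / √n` with `e_0`
(`exists_eigenvector_of_pow_eq_one`). That inner product is a coordinate, hence a lower bound for
the sup norm.

The analytic work makes this literal for tempered distributions. `translation_comm` moves the
intertwining relation from `L²` to the extension `T`. `exists_hasCoordinates` shows by Poisson
summation that `H_N(0)` is spanned by the `N` Dirac combs, so that `T` becomes a matrix
(`IsQuantization.exists_coordinate_map`). -/

/-- The Lucas sequence `0, 1, t, t² - 1, …` with `p (n + 2) = t * p (n + 1) - p n`. -/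
def lucasSeq (t : ℤ) : ℕ → ℤ
  | 0 => 0
  | 1 => 1
  | n + 2 => t * lucasSeq t (n + 1) - lucasSeq t n

theorem lucasSeq_add_two (t : ℤ) (n : ℕ) :
    lucasSeq t (n + 2) = t * lucasSeq t (n + 1) - lucasSeq t n := rfl

theorem pow_succ_eq_lucasSeq {R : Type*} [Ring R] {A : R} {t : ℤ}
    (h : A * A = (t : R) * A - 1) (n : ℕ) :
    A ^ (n + 1) = (lucasSeq t (n + 1) : R) * A - lucasSeq t n := by
  induction n with
  | zero => simp [lucasSeq]
  | succ n ih =>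
    rw [pow_succ, ih, lucasSeq_add_two, sub_mul, mul_assoc, h]
    have := (Int.cast_commute (lucasSeq t (n + 1)) (t : R)).eq
    push_cast
    rw [mul_sub, ← mul_assoc, this]
    noncomm_ring

/-- By the quadratic relation `B = 2s - A` is the inverse of `A` and satisfies the same relation.
Subtracting the Lucas formulas for the powers of `A` and `B` leaves a multiple of `A - B = 2(A -
s)`. This is where an even trace yields the extra factor `2` in the modulus. -/
theorem pow_two_mul_eq_one_add_lucasSeq {R : Type*} [Ring R] {A : R} {s : ℤ}
    (h : A * A = ((2 * s : ℤ) : R) * A - 1) (n : ℕ) :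
    A ^ (2 * (n + 1)) = 1 + ((2 * lucasSeq (2 * s) (n + 1) : ℤ) : R) * (A ^ (n + 1) * (A - s)) := by
  set B : R := ((2 * s : ℤ) : R) - A with hB
  have hAB : A * B = 1 := by
    rw [hB, mul_sub, h, (Int.cast_commute (2 * s) A).eq]; abel
  have hBA : B * A = 1 := by
    rw [hB, sub_mul, h]; abel
  have hBB : B * B = ((2 * s : ℤ) : R) * B - 1 := by
    nth_rewrite 1 [hB]
    rw [sub_mul, hAB]
  have hc : Commute A B := hAB.trans hBA.symm
  have h1 : A ^ (n + 1) * B ^ (n + 1) = 1 := by rw [← hc.mul_pow, hAB, one_pow]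
  have h2 : A ^ (n + 1) - B ^ (n + 1) = ((2 * lucasSeq (2 * s) (n + 1) : ℤ) : R) * (A - s) := by
    rw [pow_succ_eq_lucasSeq h, pow_succ_eq_lucasSeq hBB, hB]
    push_cast
    noncomm_ring
  have h3 : A ^ (2 * (n + 1)) = A ^ (n + 1) * B ^ (n + 1) +
      A ^ (n + 1) * (A ^ (n + 1) - B ^ (n + 1)) := by
    rw [two_mul, pow_add]; noncomm_ring
  rw [h3, h1, h2, ← mul_assoc, ← mul_assoc, (Int.cast_commute _ (A ^ (n + 1))).eq]

theorem odd_lucasSeq {t : ℤ} (ht : Even t) (n : ℕ) : Odd (lucasSeq t (2 * n + 1)) := by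
  induction n with
  | zero => simp [lucasSeq]
  | succ n ih =>
    rw [show 2 * (n + 1) + 1 = 2 * n + 1 + 2 by ring, lucasSeq_add_two]
    exact (ht.mul_right _).sub_odd ih

theorem pow_le_lucasSeq {t : ℤ} {lam : ℝ} (h0 : 0 < lam) (h : lam ^ 2 - t * lam + 1 = 0) (n : ℕ) :
    lam ^ n ≤ lucasSeq t (n + 1) := by
  -- The other root is `lam⁻¹`; this is the recursion with one root factored out.
  have key : ∀ n : ℕ, (lucasSeq t (n + 1) : ℝ) = lam * lucasSeq t n + (lam ^ n)⁻¹ := by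
    intro n
    induction n with
    | zero => simp [lucasSeq]
    | succ n ih =>
      rw [lucasSeq_add_two]
      push_cast
      have h1 : (t : ℝ) = lam + lam⁻¹ := by
        field_simp
        linarith
      rw [h1, pow_succ, mul_inv]
      have h2 : lam⁻¹ * (lam ^ n)⁻¹ = lam⁻¹ * (lucasSeq t (n + 1) - lam * lucasSeq t n) := by
        rw [ih]; ring
      rw [mul_comm (lam ^ n)⁻¹, h2]
      field_simp
      ring
  induction n with
  | zero => simp [lucasSeq]
  | succ n ih =>
    rw [key, pow_succ']
    have h1 : 0 ≤ (lam * lam ^ n)⁻¹ := by positivity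
    have h2 := mul_le_mul_of_nonneg_left ih h0.le
    linarith

/-! ### Eigenvectors of an isometry of finite order -/

/-- The unit vector `e` is a sum of `n` orthogonal spectral components, whose inner products with
`e` are their squared lengths and add up to `1`. Some component has squared length at least `1 / n`;
normalized, its inner product with `e` is its length. -/
theorem exists_eigenvector_of_pow_eq_one {E : Type*} [NormedAddCommGroup E]
    [InnerProductSpace ℂ E] (R : E →ₗ[ℂ] E) (hR : ∀ x, ‖R x‖ = ‖x‖) {n : ℕ} (hn : 0 < n)
    (hRn : R ^ n = 1) {e : E} (he : ‖e‖ = 1) :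
    ∃ v : E, ∃ μ : ℂ, ‖v‖ = 1 ∧ R v = μ • v ∧ 1 / √n ≤ ‖inner ℂ e v‖ := by
  set ζ : ℂ := Complex.exp (2 * Real.pi * Complex.I / n) with hζ
  have hprim : IsPrimitiveRoot ζ n := Complex.isPrimitiveRoot_exp n hn.ne'
  have hζn : ζ ^ n = 1 := hprim.pow_eq_one
  have hζ0 : ζ ≠ 0 := hprim.ne_zero hn.ne'
  have hnorm : ‖ζ‖ = 1 := Complex.norm_eq_one_of_pow_eq_one hζn hn.ne'
  have hinner : ∀ (l : ℕ) (x y : E), inner ℂ ((R ^ l) x) ((R ^ l) y) = inner ℂ x y := by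
    intro l
    induction l with
    | zero => simp
    | succ l ih =>
      intro x y
      rw [pow_succ, Module.End.mul_apply, Module.End.mul_apply, ih]
      exact (LinearMap.norm_map_iff_inner_map_map R).1 hR x y
  -- `w k` is `n` times the projection of `e` to the eigenspace of `ζ ^ k`.
  set w : ℕ → E := fun k => ∑ l ∈ Finset.range n, ((ζ ^ k)⁻¹) ^ l • (R ^ l) e with hw
  have hRw : ∀ k, R (w k) = ζ ^ k • w k := by
    intro k
    have h1 : R (w k) = ζ ^ k • ∑ l ∈ Finset.range n, ((ζ ^ k)⁻¹) ^ (l + 1) • (R ^ (l + 1)) e := by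
      rw [hw, map_sum, Finset.smul_sum]
      refine Finset.sum_congr rfl fun l _ => ?_
      rw [map_smul, smul_smul, pow_succ' R, Module.End.mul_apply, pow_succ' _ l, ← mul_assoc,
        mul_inv_cancel₀ (pow_ne_zero _ hζ0), one_mul]
    rw [h1]
    congr 1
    have h2 := Finset.sum_range_succ (fun l => ((ζ ^ k)⁻¹) ^ l • (R ^ l) e) n
    rw [Finset.sum_range_succ'] at h2
    have h3 : ((ζ ^ k)⁻¹) ^ n • (R ^ n) e = ((ζ ^ k)⁻¹) ^ 0 • (R ^ 0) e := by
      rw [hRn, inv_pow, ← pow_mul, mul_comm, pow_mul, hζn]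
      simp
    rw [h3] at h2
    exact add_right_cancel h2
  have hRlw : ∀ k l, (R ^ l) (w k) = (ζ ^ k) ^ l • w k := by
    intro k l
    induction l with
    | zero => simp
    | succ l ih => rw [pow_succ', Module.End.mul_apply, ih, map_smul, hRw, smul_smul, pow_succ]
  have hww : ∀ k, inner ℂ (w k) (w k) = n * inner ℂ e (w k) := by
    intro k
    have h1 : ∀ l ∈ Finset.range n,
        inner ℂ (((ζ ^ k)⁻¹) ^ l • (R ^ l) e) (w k) = inner ℂ e (w k) := by
      intro l _
      have h2 : w k = ((ζ ^ k)⁻¹) ^ l • (R ^ l) (w k) := by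
        rw [hRlw, smul_smul, ← mul_pow, inv_mul_cancel₀ (pow_ne_zero _ hζ0), one_pow, one_smul]
      nth_rewrite 1 [h2]
      rw [inner_smul_left, inner_smul_right, hinner, ← mul_assoc, mul_comm (starRingEnd ℂ _),
        Complex.mul_conj']
      simp [hnorm]
    nth_rewrite 1 [hw]
    rw [sum_inner, Finset.sum_congr rfl h1]
    simp
  have hsum : ∑ k ∈ Finset.range n, w k = (n : ℂ) • e := by
    rw [hw, Finset.sum_comm]
    rw [Finset.sum_eq_single_of_mem 0 (Finset.mem_range.2 hn)]
    · simp [Nat.cast_smul_eq_nsmul]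
    · intro l hl hl0
      rw [← Finset.sum_smul]
      have h1 : ∀ k ∈ Finset.range n, ((ζ ^ k)⁻¹) ^ l = ((ζ⁻¹) ^ l) ^ k := by
        intro k _
        rw [inv_pow, inv_pow, inv_pow, ← pow_mul, ← pow_mul, mul_comm]
      rw [Finset.sum_congr rfl h1]
      have h2 : (ζ⁻¹) ^ l ≠ 1 := by
        rw [inv_pow, Ne, inv_eq_one]
        intro h
        exact hl0 (Nat.eq_zero_of_dvd_of_lt (hprim.dvd_of_pow_eq_one l h) (Finset.mem_range.1 hl))
      have h3 : ((ζ⁻¹) ^ l) ^ n = 1 := by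
        rw [← pow_mul, mul_comm, pow_mul, inv_pow, hζn]
        simp
      have h4 := mul_neg_geom_sum ((ζ⁻¹) ^ l) n
      rw [h3, sub_self] at h4
      rw [(mul_eq_zero.1 h4).resolve_left (sub_ne_zero.2 h2.symm), zero_smul]
  -- The `n` numbers `⟨e, w k⟩` have sum `n`, so one of them has real part at least `1`.
  obtain ⟨k, hk, hk1⟩ : ∃ k ∈ Finset.range n, 1 ≤ (inner ℂ e (w k) : ℂ).re := by
    by_contra! hcon
    have h1 : (∑ k ∈ Finset.range n, (inner ℂ e (w k) : ℂ).re) < ∑ k ∈ Finset.range n, (1 : ℝ) :=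
      Finset.sum_lt_sum_of_nonempty ⟨0, Finset.mem_range.2 hn⟩ hcon
    rw [← Complex.re_sum, ← inner_sum, hsum, inner_smul_right, inner_self_eq_norm_sq_to_K, he] at h1
    simp at h1
  have hk2 : 1 ≤ ‖inner ℂ e (w k)‖ := hk1.trans (Complex.re_le_norm _)
  have hsq : ‖w k‖ ^ 2 = n * ‖inner ℂ e (w k)‖ := by
    have h1 := congrArg norm (hww k)
    rw [inner_self_eq_norm_sq_to_K, norm_mul, norm_pow] at h1
    simpa using h1
  have hn' : (0 : ℝ) < n := by exact_mod_cast hn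
  have hpos : 0 < ‖w k‖ := by
    have : 0 < ‖w k‖ ^ 2 := by rw [hsq]; positivity
    exact lt_of_le_of_ne (norm_nonneg _) fun h => by rw [← h] at this; norm_num at this
  refine ⟨((‖w k‖⁻¹ : ℝ) : ℂ) • w k, ζ ^ k, ?_, ?_, ?_⟩
  · rw [norm_smul, Complex.norm_real, norm_inv, norm_norm, inv_mul_cancel₀ hpos.ne']
  · rw [map_smul, hRw, smul_comm]
  · rw [inner_smul_right, norm_mul, Complex.norm_real, norm_inv, norm_norm]
    rw [div_le_iff₀ (by positivity)]
    refine le_of_sq_le_sq ?_ (by positivity)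
    rw [one_pow, mul_pow, mul_pow, Real.sq_sqrt hn'.le, inv_pow, hsq]
    have : 0 < ‖inner ℂ e (w k)‖ := by linarith
    field_simp
    exact hk2

/-- Dividing `S` by an `n`-th root of `κ`, which has modulus one, reduces this to the case of finite
order. -/
theorem exists_eigenvector_of_pow_eq_smul_one {E : Type*} [NormedAddCommGroup E]
    [InnerProductSpace ℂ E] (S : E →ₗ[ℂ] E) (hS : ∀ x, ‖S x‖ = ‖x‖) {n : ℕ} (hn : 0 < n) {κ : ℂ}
    (hSn : S ^ n = κ • 1) {e : E} (he : ‖e‖ = 1) :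
    ∃ v : E, ∃ μ : ℂ, ‖v‖ = 1 ∧ S v = μ • v ∧ 1 / √n ≤ ‖inner ℂ e v‖ := by
  obtain ⟨ρ, hρ⟩ := IsAlgClosed.exists_pow_nat_eq κ hn
  have hpow : ∀ (l : ℕ) (x : E), ‖(S ^ l) x‖ = ‖x‖ := by
    intro l
    induction l with
    | zero => simp
    | succ l ih => intro x; rw [pow_succ', Module.End.mul_apply, hS, ih]
  have hκ : ‖κ‖ = 1 := by
    have := hpow n e
    rw [hSn, LinearMap.smul_apply, Module.End.one_apply, norm_smul, he, mul_one] at this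
    exact this
  have hρ1 : ‖ρ‖ = 1 := by
    rw [← hρ, norm_pow] at hκ
    exact (pow_eq_one_iff_of_nonneg (norm_nonneg _) hn.ne').1 hκ
  have hρ0 : ρ ≠ 0 := by
    rintro rfl
    simp at hρ1
  obtain ⟨v, μ, h1, h2, h3⟩ := exists_eigenvector_of_pow_eq_one (ρ⁻¹ • S)
    (fun x => by rw [LinearMap.smul_apply, norm_smul, norm_inv, hρ1, hS]; simp) hn
    (by rw [smul_pow, hSn, smul_smul, inv_pow, hρ, inv_mul_cancel₀, one_smul]
        rw [← hρ]; exact pow_ne_zero _ hρ0) he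
  refine ⟨v, ρ * μ, h1, ?_, h3⟩
  rw [mul_smul, ← h2, LinearMap.smul_apply, smul_smul, mul_inv_cancel₀ hρ0, one_smul]

namespace CatMap

/-! ### Quantum translations as Weyl quantizations of exponentials -/

open scoped FourierTransform in
-- Fourier inversion after the substitution `ξ = 2πhs`: the symbol `1` quantizes to the identity.
theorem integral_integral_exp_mul {h : ℝ} (hh : 0 < h) (g : 𝓢(ℝ, ℂ)) (x : ℝ) :
    (1 / (2 * Real.pi * h) : ℝ) * ∫ ξ : ℝ, ∫ x' : ℝ,
      Complex.exp (Complex.I * ((x - x') * ξ / h : ℝ)) * g x' = g x := by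
  have h0 : (2 * Real.pi * h) ≠ 0 := by positivity
  have h1 : ∀ ξ : ℝ, ∫ x' : ℝ, Complex.exp (Complex.I * ((x - x') * ξ / h : ℝ)) * g x' =
      (fun s : ℝ => Real.fourierChar (s * x) • 𝓕 (g : ℝ → ℂ) s) (ξ / (2 * Real.pi * h)) := by
    intro ξ
    simp only
    rw [Real.fourier_real_eq, Circle.smul_def, smul_eq_mul, ← integral_const_mul]
    refine integral_congr_ae (Filter.Eventually.of_forall fun x' => ?_)
    simp only [Circle.smul_def, smul_eq_mul, Real.fourierChar_apply]
    rw [← mul_assoc, ← Complex.exp_add]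
    congr 2
    push_cast
    have : (h : ℂ) ≠ 0 := by exact_mod_cast hh.ne'
    field_simp
    ring
  simp_rw [h1]
  rw [Measure.integral_comp_div
    (fun s : ℝ => Real.fourierChar (s * x) • 𝓕 (g : ℝ → ℂ) s) (2 * Real.pi * h)]
  have h2 : ∫ s : ℝ, Real.fourierChar (s * x) • 𝓕 (g : ℝ → ℂ) s = g x := by
    have h3 : 𝓕⁻ (𝓕 (g : ℝ → ℂ)) x = g x := by
      rw [← SchwartzMap.fourier_coe, ← SchwartzMap.fourierInv_coe,
        FourierTransform.fourierInv_fourier_eq]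
    rw [Real.fourierInv_eq] at h3
    rw [← h3]
    simp [mul_comm]
  rw [h2, abs_of_pos (by positivity), Complex.real_smul, ← mul_assoc, ← Complex.ofReal_mul,
    one_div_mul_cancel h0]
  simp

/-- The exponential `exp (i (η x - y ξ) / h)`, the Weyl symbol of `U_(y, η)`. -/
noncomputable def translationSymbol (h : ℝ) (ω : ℝ × ℝ) (z : ℝ × ℝ) : ℂ :=
  Complex.exp (Complex.I * ((ω.2 * z.1 - ω.1 * z.2) / h : ℝ))

theorem iteratedDeriv_wave (c : ℝ) (n : ℕ) :
    iteratedDeriv n (wave c) = fun x => (Complex.I * c) ^ n * wave c x := by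
  induction n with
  | zero => simp
  | succ n ih =>
    rw [iteratedDeriv_succ, ih]
    funext x
    have h1 : HasDerivAt (wave c) (wave c x * (Complex.I * c)) x := by
      unfold wave
      refine HasDerivAt.cexp ?_
      simpa using ((hasDerivAt_id x).const_mul c).ofReal_comp.const_mul Complex.I
    rw [(h1.const_mul _).deriv]
    ring

theorem norm_wave (c x : ℝ) : ‖wave c x‖ = 1 := by
  simp [wave, Complex.norm_exp]

theorem isSymbol_translationSymbol (h : ℝ) (ω : ℝ × ℝ) : IsSymbol (translationSymbol h ω) := by
  set L : ℝ × ℝ →L[ℝ] ℝ := (ω.2 / h) • ContinuousLinearMap.fst ℝ ℝ ℝ -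
    (ω.1 / h) • ContinuousLinearMap.snd ℝ ℝ ℝ with hL
  have e : translationSymbol h ω = wave 1 ∘ L := by
    funext z
    simp only [translationSymbol, wave, hL, Function.comp_apply, sub_apply, smul_apply,
      ContinuousLinearMap.coe_fst', ContinuousLinearMap.coe_snd', smul_eq_mul]
    congr 3
    ring
  have hw : ContDiff ℝ (⊤ : ℕ∞) (wave 1) := (wave_hasTemperateGrowth 1).1
  refine ⟨?_, fun n => ⟨‖L‖ ^ n, fun z => ?_⟩⟩
  · rw [e]
    exact hw.comp L.contDiff
  · rw [e, L.iteratedFDeriv_comp_right hw z (i := n) (by exact_mod_cast le_top)]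
    refine (ContinuousMultilinearMap.norm_compContinuousLinearMap_le _ _).trans ?_
    rw [norm_iteratedFDeriv_eq_norm_iteratedDeriv, iteratedDeriv_wave]
    simp [norm_wave]

/-- The factor `exp (-iyξ/h)` moves the evaluation point from `x` to `x - y`. Of the midpoint phase
`η(x + x')/2h`, half is constant in the integrals and half multiplies `f`, so the case of symbol `1`
applies. -/
theorem weylOp_translationSymbol {h : ℝ} (hh : 0 < h) (ω : ℝ × ℝ) (f : 𝓢(ℝ, ℂ)) (x : ℝ) :
    weylOp h (translationSymbol h ω) f x = translationS h ω f x := by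
  have h1 := integral_integral_exp_mul hh
    (Complex.exp (Complex.I * (ω.2 * x / (2 * h) : ℝ)) •
      SchwartzMap.smulLeftCLM ℂ (wave (ω.2 / (2 * h))) f) (x - ω.1)
  simp only [smul_apply, SchwartzMap.smulLeftCLM_apply_apply (wave_hasTemperateGrowth _),
    smul_eq_mul, wave] at h1
  rw [translationS_apply, weylOp]
  convert h1 using 1
  · congr 1
    refine integral_congr_ae (Filter.Eventually.of_forall fun ξ => ?_)
    refine integral_congr_ae (Filter.Eventually.of_forall fun x' => ?_)
    simp only [translationSymbol]
    rw [← mul_assoc, ← mul_assoc, ← Complex.exp_add, ← Complex.exp_add, ← Complex.exp_add]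
    congr 2
    have : (h : ℂ) ≠ 0 := by exact_mod_cast hh.ne'
    push_cast
    field_simp
    ring
  · rw [← mul_assoc, ← Complex.exp_add]
    congr 2
    have : (h : ℂ) ≠ 0 := by exact_mod_cast hh.ne'
    push_cast
    field_simp
    ring

theorem norm_toLp_translationS (h : ℝ) (ω : ℝ × ℝ) (f : 𝓢(ℝ, ℂ)) :
    ‖(translationS h ω f).toLp 2‖ = ‖f.toLp 2‖ := by
  rw [SchwartzMap.norm_toLp, SchwartzMap.norm_toLp]
  congr 1
  have h1 : eLpNorm (translationS h ω f) 2 volume =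
      eLpNorm ((f : ℝ → ℂ) ∘ fun x => x - ω.1) 2 volume := by
    refine eLpNorm_congr_norm_ae (Filter.Eventually.of_forall fun x => ?_)
    rw [translationS_apply, norm_mul, mul_comm Complex.I, Complex.norm_exp_ofReal_mul_I, one_mul]
    rfl
  rw [h1]
  exact eLpNorm_comp_measurePreserving f.continuous.aestronglyMeasurable
    (measurePreserving_sub_right volume ω.1)

/-- The quantum translation `U_ω` on `L²(ℝ)`. -/
noncomputable def translationL2 (h : ℝ) (ω : ℝ × ℝ) : L2 →L[ℂ] L2 :=
  LinearMap.extendOfNorm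
    ((SchwartzMap.toLpCLM ℂ ℂ 2 volume).toLinearMap ∘ₗ (translationS h ω).toLinearMap)
    (SchwartzMap.toLpCLM ℂ ℂ 2 volume).toLinearMap

theorem denseRange_toL2 : DenseRange fun f : 𝓢(ℝ, ℂ) => (f.toLp 2 : L2) :=
  SchwartzMap.denseRange_toLpCLM ENNReal.ofNat_ne_top

theorem translationL2_toLp (h : ℝ) (ω : ℝ × ℝ) (f : 𝓢(ℝ, ℂ)) :
    translationL2 h ω (f.toLp 2) = (translationS h ω f).toLp 2 :=
  LinearMap.extendOfNorm_eq
    (f := (SchwartzMap.toLpCLM ℂ ℂ 2 volume).toLinearMap ∘ₗ (translationS h ω).toLinearMap)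
    (e := (SchwartzMap.toLpCLM ℂ ℂ 2 volume).toLinearMap) denseRange_toL2
    ⟨1, fun f => by rw [one_mul]; exact (norm_toLp_translationS h ω f).le⟩ f

theorem isWeylQuantization_translationL2 {h : ℝ} (hh : 0 < h) (ω : ℝ × ℝ) :
    IsWeylQuantization h (translationSymbol h ω) (translationL2 h ω) := by
  intro f
  rw [translationL2_toLp]
  filter_upwards [SchwartzMap.coeFn_toLp (translationS h ω f) 2 volume] with x hx
  rw [hx, weylOp_translationSymbol hh]

/-- The exponent is the symplectic form of `ω` and `z`, which a matrix of determinant one preserves.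
-/
theorem translationSymbol_comp_act (h : ℝ) (A : Matrix.SpecialLinearGroup (Fin 2) ℝ) (ω : ℝ × ℝ) :
    translationSymbol h (act A ω) ∘ act A = translationSymbol h ω := by
  have hdet := A.det_coe
  rw [Matrix.det_fin_two] at hdet
  funext z
  simp only [translationSymbol, act, Function.comp_apply]
  congr 3
  linear_combination (ω.2 * z.1 - ω.1 * z.2) / h * hdet

theorem IsMetaplectic.translationL2_comm {h : ℝ} (hh : 0 < h)
    {A : Matrix.SpecialLinearGroup (Fin 2) ℝ} {M : L2 ≃ₗᵢ[ℂ] L2} (hM : IsMetaplectic h A M)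
    (ω : ℝ × ℝ) (f : L2) : M (translationL2 h ω f) = translationL2 h (act A ω) (M f) := by
  have h1 := hM (translationSymbol h (act A ω)) (isSymbol_translationSymbol h _)
    (translationL2 h (act A ω)) (translationL2 h ω) (isWeylQuantization_translationL2 hh _)
    (by rw [translationSymbol_comp_act]; exact isWeylQuantization_translationL2 hh ω) f
  rw [← h1, LinearIsometryEquiv.apply_symm_apply]

/-! ### Transfer to tempered distributions -/

theorem translation_toTemperedDistribution (h : ℝ) (ω : ℝ × ℝ) (f : L2) :
    translation h ω (Lp.toTemperedDistribution f) =
      Lp.toTemperedDistribution (translationL2 h ω f) := by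
  have h1 : (fun f : L2 => translation h ω (Lp.toTemperedDistributionCLM ℂ volume 2 f)) =
      fun f : L2 => Lp.toTemperedDistributionCLM ℂ volume 2 (translationL2 h ω f) := by
    refine denseRange_toL2.equalizer (by fun_prop) (by fun_prop) ?_
    funext f
    simp only [Function.comp_apply, Lp.toTemperedDistributionCLM_apply, translationL2_toLp,
      Lp.toTemperedDistribution_toLp_eq, translation_coe]
  exact congrFun h1 f

/-- A continuous functional on the tempered distributions is evaluation at a Schwartz function. -/
theorem exists_eq_eval (φ : 𝓢'(ℝ, ℂ) →L[ℂ] ℂ) : ∃ g : 𝓢(ℝ, ℂ), ∀ u : 𝓢'(ℝ, ℂ), φ u = u g := by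
  let e := PointwiseConvergenceCLM.equivWeakDual ℂ 𝓢(ℝ, ℂ)
  obtain ⟨g, hg⟩ := LinearMap.dualEmbedding_surjective (topDualPairing ℂ 𝓢(ℝ, ℂ))
    (φ ∘L e.symm.toContinuousLinearMap)
  refine ⟨g, fun u => ?_⟩
  have := DFunLike.congr_fun hg (e u)
  have h2 : (φ ∘L e.symm.toContinuousLinearMap) (e u) = φ u := by simp
  exact h2.symm.trans this.symm

theorem eq_zero_of_integral_mul_eq_zero {g : 𝓢(ℝ, ℂ)}
    (hg : ∀ f : 𝓢(ℝ, ℂ), (f : 𝓢'(ℝ, ℂ)) g = 0) : g = 0 := by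
  have h1 : (g : 𝓢'(ℝ, ℂ)) = 0 := by
    ext f
    have h2 := hg f
    simp only [SchwartzMap.toTemperedDistributionCLM_apply_apply, smul_eq_mul] at h2 ⊢
    simp_rw [mul_comm (f _)]
    exact h2
  have h3 : Lp.toTemperedDistributionCLM ℂ volume 2 (g.toLp 2) = 0 := by
    rw [Lp.toTemperedDistributionCLM_apply, Lp.toTemperedDistribution_toLp_eq, h1]
  have h4 : g.toLp 2 (volume : Measure ℝ) = 0 := by
    have := Lp.ker_toTemperedDistributionCLM_eq_bot (F := ℂ) (μ := (volume : Measure ℝ)) (p := 2)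
    exact (LinearMap.ker_eq_bot'.1 this) _ h3
  refine SchwartzMap.injective_toLp 2 volume ?_
  exact h4.trans (map_zero (SchwartzMap.toLpCLM ℂ ℂ 2 volume)).symm

/-- Schwartz functions are weakly dense: a continuous functional on `𝓢'` is evaluation at a Schwartz
function, and one that vanishes on `𝓢` is evaluation at `0`. -/
theorem eq_of_eq_on_schwartz {T₁ T₂ : 𝓢'(ℝ, ℂ) →L[ℂ] 𝓢'(ℝ, ℂ)}
    (h : ∀ f : 𝓢(ℝ, ℂ), T₁ (f : 𝓢'(ℝ, ℂ)) = T₂ (f : 𝓢'(ℝ, ℂ))) : T₁ = T₂ := by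
  ext u g
  obtain ⟨k, hk⟩ := exists_eq_eval (PointwiseConvergenceCLM.evalCLM (RingHom.id ℂ) ℂ g ∘L (T₁ - T₂))
  have hk0 : k = 0 := eq_zero_of_integral_mul_eq_zero fun f => by
    rw [← hk]
    simp [h]
  have := hk u
  rw [hk0, map_zero] at this
  exact sub_eq_zero.1 this

theorem translation_comm {h : ℝ} (hh : 0 < h)
    {A : Matrix.SpecialLinearGroup (Fin 2) ℝ} {M : L2 ≃ₗᵢ[ℂ] L2} (hM : IsMetaplectic h A M)
    {T : 𝓢'(ℝ, ℂ) →L[ℂ] 𝓢'(ℝ, ℂ)} (hT : IsTemperedExtension M T) (ω : ℝ × ℝ) (u : 𝓢'(ℝ, ℂ)) :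
    T (translation h ω u) = translation h (act A ω) (T u) := by
  have h1 : T ∘L translation h ω = translation h (act A ω) ∘L T := by
    refine eq_of_eq_on_schwartz fun f => ?_
    rw [← Lp.toTemperedDistribution_toLp_eq (p := 2), ContinuousLinearMap.comp_apply,
      ContinuousLinearMap.comp_apply, translation_toTemperedDistribution, hT, hT,
      translation_toTemperedDistribution, hM.translationL2_comm hh]
  exact DFunLike.congr_fun h1 u

end CatMap

/-! ### Series of Schwartz functions -/

theorem SchwartzMap.summable_apply_of_summable_seminorm {ι : Type*} {φ : ι → 𝓢(ℝ, ℂ)}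
    (hφ : ∀ k n, Summable fun i => SchwartzMap.seminorm ℝ k n (φ i)) (x : ℝ) :
    Summable fun i => φ i x :=
  .of_norm_bounded (hφ 0 0) fun i => (φ i).norm_le_seminorm ℝ x

/-- Summable seminorms allow termwise differentiation. The seminorm bound is stated because it is
applied to tails in `SchwartzMap.hasSum_of_summable_seminorm`. -/
theorem SchwartzMap.exists_eq_tsum {ι : Type*} {φ : ι → 𝓢(ℝ, ℂ)}
    (hφ : ∀ k n, Summable fun i => SchwartzMap.seminorm ℝ k n (φ i)) :
    ∃ Φ : 𝓢(ℝ, ℂ), (∀ x, Φ x = ∑' i, φ i x) ∧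
      ∀ k n, SchwartzMap.seminorm ℝ k n Φ ≤ ∑' i, SchwartzMap.seminorm ℝ k n (φ i) := by
  have hs : ∀ i, ContDiff ℝ (⊤ : ℕ∞) (φ i) := fun i => (φ i).smooth ⊤
  have hb : ∀ (k : ℕ) (i : ι) (x : ℝ), (k : ℕ∞) ≤ ⊤ →
      ‖iteratedFDeriv ℝ k (φ i) x‖ ≤ SchwartzMap.seminorm ℝ 0 k (φ i) :=
    fun k i x _ => (φ i).norm_iteratedFDeriv_le_seminorm ℝ k x
  have hdec : ∀ (k n : ℕ) (x : ℝ), ‖x‖ ^ k * ‖iteratedFDeriv ℝ n (fun x => ∑' i, φ i x) x‖ ≤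
      ∑' i, SchwartzMap.seminorm ℝ k n (φ i) := by
    intro k n x
    rw [iteratedFDeriv_tsum_apply hs (fun k _ => hφ 0 k) hb le_top]
    have h1 : Summable fun i => ‖iteratedFDeriv ℝ n (φ i) x‖ :=
      .of_nonneg_of_le (fun _ => norm_nonneg _) (fun i => hb n i x le_top) (hφ 0 n)
    calc ‖x‖ ^ k * ‖∑' i, iteratedFDeriv ℝ n (φ i) x‖
        ≤ ‖x‖ ^ k * ∑' i, ‖iteratedFDeriv ℝ n (φ i) x‖ := by
          gcongr
          exact norm_tsum_le_tsum_norm h1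
      _ = ∑' i, ‖x‖ ^ k * ‖iteratedFDeriv ℝ n (φ i) x‖ := tsum_mul_left.symm
      _ ≤ _ := (h1.mul_left _).tsum_le_tsum (fun i => (φ i).le_seminorm ℝ k n x) (hφ k n)
  refine ⟨⟨fun x => ∑' i, φ i x, contDiff_tsum hs (fun k _ => hφ 0 k) hb,
    fun k n => ⟨_, hdec k n⟩⟩, fun x => rfl, fun k n => ?_⟩
  exact SchwartzMap.seminorm_le_bound ℝ k n _
    (tsum_nonneg fun i => apply_nonneg (SchwartzMap.seminorm ℝ k n) _) (hdec k n)

theorem SchwartzMap.hasSum_of_summable_seminorm {ι : Type*} {φ : ι → 𝓢(ℝ, ℂ)} {Φ : 𝓢(ℝ, ℂ)}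
    (hφ : ∀ k n, Summable fun i => SchwartzMap.seminorm ℝ k n (φ i))
    (hΦ : ∀ x, Φ x = ∑' i, φ i x) : HasSum φ Φ := by
  classical
  refine ((schwartz_withSeminorms ℝ ℝ ℂ).tendsto_nhds _ _).2 fun ⟨k, n⟩ ε hε => ?_
  have h1 := tendsto_tsum_compl_atTop_zero fun i => SchwartzMap.seminorm ℝ k n (φ i)
  filter_upwards [h1.eventually (gt_mem_nhds hε)] with s hs
  obtain ⟨Ψ, hΨ, hΨ'⟩ := SchwartzMap.exists_eq_tsum
    (φ := fun i : { i // i ∉ s } => φ i) fun k n => (hφ k n).subtype _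
  have h2 : ∑ i ∈ s, φ i - Φ = -Ψ := by
    ext x
    have h3 := (SchwartzMap.summable_apply_of_summable_seminorm hφ x).sum_add_tsum_subtype_compl s
    have h4 : (∑ i ∈ s, φ i) x = ∑ i ∈ s, φ i x := by simp
    rw [sub_apply, neg_apply, hΨ, hΦ, h4, ← h3]
    ring
  rw [h2, map_neg_eq_map]
  exact (hΨ' k n).trans_lt hs

/-- The product `x ↦ g x * f (x - s)` of Schwartz functions. -/
noncomputable def SchwartzMap.mulShift (g f : 𝓢(ℝ, ℂ)) (s : ℝ) : 𝓢(ℝ, ℂ) :=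
  SchwartzMap.smulLeftCLM ℂ g (SchwartzMap.compSubConstCLM ℂ s f)

theorem SchwartzMap.mulShift_apply (g f : 𝓢(ℝ, ℂ)) (s x : ℝ) :
    g.mulShift f s x = g x * f (x - s) := by
  simp [SchwartzMap.mulShift, SchwartzMap.smulLeftCLM_apply_apply g.hasTemperateGrowth]

theorem SchwartzMap.exists_one_add_abs_pow_mul_le (f : 𝓢(ℝ, ℂ)) (k n : ℕ) :
    ∃ C : ℝ, 0 ≤ C ∧ ∀ x : ℝ, ∀ i ≤ n, (1 + |x|) ^ k * ‖iteratedFDeriv ℝ i f x‖ ≤ C :=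
  ⟨2 ^ k * (Finset.Iic (k, n)).sup (schwartzSeminormFamily ℝ ℝ ℂ) f, by positivity,
    fun x _ hi => SchwartzMap.one_add_le_sup_seminorm_apply (𝕜 := ℝ) (m := (k, n)) le_rfl hi f x⟩

/-- In the Leibniz rule, the decay of both factors is traded for decay in the shift through `1 + |s|
≤ (1 + |x|)(1 + |x - s|)`. The exponent `2` makes the bound summable over integer shifts. -/
theorem SchwartzMap.exists_seminorm_mulShift_le (g f : 𝓢(ℝ, ℂ)) (k n : ℕ) :
    ∃ C : ℝ, 0 ≤ C ∧
      ∀ s : ℝ, SchwartzMap.seminorm ℝ k n (g.mulShift f s) ≤ C * ((1 + |s|) ^ 2)⁻¹ := by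
  obtain ⟨C, hC0, hC⟩ := g.exists_one_add_abs_pow_mul_le (k + 2) n
  obtain ⟨D, hD0, hD⟩ := f.exists_one_add_abs_pow_mul_le 2 n
  refine ⟨∑ i ∈ Finset.range (n + 1), (n.choose i : ℝ) * (C * D), by positivity, fun s => ?_⟩
  refine SchwartzMap.seminorm_le_bound ℝ k n _ (by positivity) fun x => ?_
  have e : (g.mulShift f s : ℝ → ℂ) = fun x => g x * f (x - s) := by
    funext x
    exact SchwartzMap.mulShift_apply g f s x
  have h1 : ‖iteratedFDeriv ℝ n (fun x => g x * f (x - s)) x‖ ≤ ∑ i ∈ Finset.range (n + 1),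
      n.choose i * ‖iteratedFDeriv ℝ i g x‖ * ‖iteratedFDeriv ℝ (n - i) f (x - s)‖ := by
    simp_rw [← iteratedFDeriv_comp_sub _ s x]
    exact norm_iteratedFDeriv_mul_le (n := n) (g.smooth ⊤)
      ((f.smooth ⊤).comp (contDiff_id.sub contDiff_const : ContDiff ℝ _ fun x : ℝ => x - s)) x
      (by exact_mod_cast le_top)
  rw [e]
  refine (mul_le_mul_of_nonneg_left h1 (by positivity)).trans ?_
  rw [Finset.mul_sum, Finset.sum_mul]
  refine Finset.sum_le_sum fun i hi => ?_
  have hi' : i ≤ n := Nat.lt_succ_iff.1 (Finset.mem_range.1 hi)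
  have h2 := hC x i hi'
  have h3 := hD (x - s) (n - i) (Nat.sub_le _ _)
  have h4 : 1 + |s| ≤ (1 + |x|) * (1 + |x - s|) := by
    have : |s| ≤ |x| + |x - s| := by
      calc |s| = |x - (x - s)| := by rw [sub_sub_cancel]
        _ ≤ _ := abs_sub _ _
    nlinarith [abs_nonneg x, abs_nonneg (x - s)]
  rw [← div_eq_mul_inv, le_div_iff₀ (by positivity)]
  calc ‖x‖ ^ k * (n.choose i * ‖iteratedFDeriv ℝ i g x‖ * ‖iteratedFDeriv ℝ (n - i) f (x - s)‖) *
        (1 + |s|) ^ 2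
      ≤ (1 + |x|) ^ k * (n.choose i * ‖iteratedFDeriv ℝ i g x‖ *
          ‖iteratedFDeriv ℝ (n - i) f (x - s)‖) * ((1 + |x|) * (1 + |x - s|)) ^ 2 := by
        gcongr
        rw [Real.norm_eq_abs]
        linarith
    _ = n.choose i * (((1 + |x|) ^ (k + 2) * ‖iteratedFDeriv ℝ i g x‖) *
          ((1 + |x - s|) ^ 2 * ‖iteratedFDeriv ℝ (n - i) f (x - s)‖)) := by ring
    _ ≤ _ := by gcongr

theorem SchwartzMap.summable_seminorm_mulShift (g f : 𝓢(ℝ, ℂ)) {p : ℕ} (hp : 0 < p) (k n : ℕ) :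
    Summable fun m : ℤ => SchwartzMap.seminorm ℝ k n (g.mulShift f (m * p)) := by
  obtain ⟨C, hC0, hC⟩ := g.exists_seminorm_mulShift_le f k n
  refine .of_nonneg_of_le (fun _ => apply_nonneg _ _) (fun m => hC _) (.mul_left _ ?_)
  refine .of_nonneg_of_le (fun _ => by positivity) (fun m => ?_) (CatMap.summable_comb_weight 0)
  rw [add_zero, abs_mul]
  have : (1 : ℝ) ≤ |(p : ℝ)| := by
    rw [Nat.abs_cast]
    exact_mod_cast hp
  gcongr
  exact le_mul_of_one_le_right (abs_nonneg _) this

/-! ### Periodic tempered distributions -/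

open scoped FourierTransform

/-- Take the inverse Fourier transform of a bump that is `1` at `0` and `0` at the other integers;
in Poisson summation only the zero frequency survives. -/
theorem exists_schwartz_tsum_eq_one : ∃ χ : 𝓢(ℝ, ℂ), ∀ x : ℝ, ∑' n : ℤ, χ (x + n) = 1 := by
  let b : ContDiffBump (0 : ℝ) := ⟨1 / 4, 1 / 2, by norm_num, by norm_num⟩
  have hb : ContDiff ℝ (⊤ : ℕ∞) fun x => (b x : ℂ) := Complex.ofRealCLM.contDiff.comp b.contDiff
  have hc : HasCompactSupport fun x => (b x : ℂ) := b.hasCompactSupport.comp_left Complex.ofReal_zero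
  let B : 𝓢(ℝ, ℂ) := hc.toSchwartzMap hb
  have hB : ∀ x, B x = b x := fun x => rfl
  refine ⟨𝓕⁻ B, fun x => ?_⟩
  rw [SchwartzMap.tsum_eq_tsum_fourier, FourierTransform.fourier_fourierInv_eq,
    tsum_eq_single 0]
  · rw [hB, b.one_of_mem_closedBall]
    · simp
    · simp only [Int.cast_zero]
      exact Metric.mem_closedBall_self b.rIn_pos.le
  · intro n hn
    rw [hB, b.zero_of_le_dist, Complex.ofReal_zero, zero_mul]
    rw [Real.dist_eq, sub_zero]
    have : (1 : ℝ) ≤ |(n : ℝ)| := by exact_mod_cast Int.one_le_abs hn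
    exact le_trans (by norm_num [b]) this

/-- The dilation `x ↦ f (p x)` of a Schwartz function. -/
noncomputable def SchwartzMap.dilate (f : 𝓢(ℝ, ℂ)) {p : ℝ} (hp : p ≠ 0) : 𝓢(ℝ, ℂ) :=
  SchwartzMap.compCLMOfContinuousLinearEquiv ℂ
    (ContinuousLinearEquiv.smulLeft (Units.mk0 p hp) : ℝ ≃L[ℝ] ℝ) f

theorem SchwartzMap.dilate_apply (f : 𝓢(ℝ, ℂ)) {p : ℝ} (hp : p ≠ 0) (x : ℝ) :
    f.dilate hp x = f (p * x) := by
  simp [SchwartzMap.dilate, Units.smul_def]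

theorem exists_schwartz_tsum_mul_eq_one {p : ℕ} (hp : 0 < p) :
    ∃ χ : 𝓢(ℝ, ℂ), ∀ x : ℝ, ∑' n : ℤ, χ (x + n * p) = 1 := by
  obtain ⟨χ, hχ⟩ := exists_schwartz_tsum_eq_one
  have h0 : (p : ℝ) ≠ 0 := by exact_mod_cast hp.ne'
  refine ⟨χ.dilate (inv_ne_zero h0), fun x => ?_⟩
  rw [← hχ ((p : ℝ)⁻¹ * x)]
  congr 1
  funext n
  rw [SchwartzMap.dilate_apply]
  congr 1
  field_simp

/-- A periodic tempered distribution only depends on the periodization of its argument. -/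
theorem exists_eq_mul_periodization {p : ℕ} (hp : 0 < p) {v : 𝓢'(ℝ, ℂ)}
    (hv : ∀ (k : ℤ) (f : 𝓢(ℝ, ℂ)), v (SchwartzMap.compSubConstCLM ℂ ((k : ℝ) * p) f) = v f)
    (f : 𝓢(ℝ, ℂ)) :
    ∃ χ φ : 𝓢(ℝ, ℂ), v f = v φ ∧ ∀ x, φ x = χ x * ∑' k : ℤ, f (x + k * p) := by
  obtain ⟨χ, hχ⟩ := exists_schwartz_tsum_mul_eq_one hp
  have hneg : ∀ (g : 𝓢(ℝ, ℂ)) (x : ℝ), ∑' k : ℤ, g (x - k * p) = ∑' k : ℤ, g (x + k * p) := by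
    intro g x
    rw [← (Equiv.neg ℤ).tsum_eq]
    congr 1
    funext k
    simp
  obtain ⟨φ, hφ, -⟩ := SchwartzMap.exists_eq_tsum (χ.summable_seminorm_mulShift f hp)
  -- The partition of unity splits `f` as `∑ k, f(x) χ(x - kp)`. By periodicity each piece may be
  -- translated back to `χ(x) f(x + kp)` under `v`, and these sum to `φ`.
  have h1 : HasSum (fun k : ℤ => f.mulShift χ (k * p)) f :=
    SchwartzMap.hasSum_of_summable_seminorm (f.summable_seminorm_mulShift χ hp) fun x => by
      simp_rw [SchwartzMap.mulShift_apply]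
      rw [tsum_mul_left, hneg, hχ, mul_one]
  have h2 : HasSum (fun k : ℤ => χ.mulShift f (k * p)) φ :=
    SchwartzMap.hasSum_of_summable_seminorm (χ.summable_seminorm_mulShift f hp) hφ
  have h3 := h1.map v (map_continuous v)
  have h4 := h2.map v (map_continuous v)
  refine ⟨χ, φ, ?_, fun x => ?_⟩
  · refine h3.unique ?_
    rw [← (Equiv.neg ℤ).hasSum_iff] at h4
    convert h4 using 1
    funext k
    simp only [Function.comp_apply]
    rw [← hv k (χ.mulShift f _)]
    congr 1
    ext x
    simp only [SchwartzMap.mulShift_apply, SchwartzMap.compSubConstCLM_apply, Equiv.neg_apply]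
    rw [mul_comm]
    congr 2
    push_cast
    ring
  · rw [hφ]
    simp_rw [SchwartzMap.mulShift_apply]
    rw [tsum_mul_left, hneg]

theorem eq_zero_of_periodization_eq_zero {p : ℕ} (hp : 0 < p) {v : 𝓢'(ℝ, ℂ)}
    (hv : ∀ (k : ℤ) (f : 𝓢(ℝ, ℂ)), v (SchwartzMap.compSubConstCLM ℂ ((k : ℝ) * p) f) = v f)
    {f : 𝓢(ℝ, ℂ)} (hf : ∀ x : ℝ, ∑' k : ℤ, f (x + k * p) = 0) : v f = 0 := by
  obtain ⟨χ, φ, h1, h2⟩ := exists_eq_mul_periodization hp hv f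
  have h3 : φ = 0 := by
    ext x
    rw [h2, hf, mul_zero]
    rfl
  rw [h1, h3, map_zero]

/-- Poisson summation for `x ↦ 𝓕 f (N x)`: its Fourier transform at the integer `n` is a multiple of
`f (-n / N)`. -/
theorem tsum_fourier_eq_zero {N : ℕ} (hN : 0 < N) {f : 𝓢(ℝ, ℂ)}
    (hf : ∀ n : ℤ, f ((n : ℝ) / N) = 0) (ξ : ℝ) : ∑' k : ℤ, 𝓕 f (ξ + k * N) = 0 := by
  have h0 : (N : ℝ) ≠ 0 := by exact_mod_cast hN.ne'
  have h1 := SchwartzMap.tsum_eq_tsum_fourier ((𝓕 f).dilate h0) (ξ / N)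
  have h2 : ∀ n : ℤ, (𝓕 ((𝓕 f).dilate h0) : 𝓢(ℝ, ℂ)) (n : ℝ) = 0 := by
    intro n
    have h3 : (𝓕 ((𝓕 f).dilate h0) : 𝓢(ℝ, ℂ)) (n : ℝ) =
        ∫ v : ℝ, (fun w : ℝ => Real.fourierChar (-(w * (n / N))) • (𝓕 f : 𝓢(ℝ, ℂ)) w) (v * N) := by
      rw [SchwartzMap.fourier_coe, Real.fourier_real_eq]
      congr 1
      funext v
      simp only [SchwartzMap.dilate_apply]
      rw [mul_comm (N : ℝ) v]
      congr 3
      field_simp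
    rw [h3, Measure.integral_comp_mul_right
      (fun w : ℝ => Real.fourierChar (-(w * (n / N))) • (𝓕 f : 𝓢(ℝ, ℂ)) w) (N : ℝ)]
    have h4 := Real.fourier_real_eq ((𝓕 f : 𝓢(ℝ, ℂ)) : ℝ → ℂ) ((n : ℝ) / N)
    rw [← h4]
    have h5 : 𝓕⁻ (𝓕 (f : ℝ → ℂ)) (-((n : ℝ) / N)) = 0 := by
      rw [← SchwartzMap.fourier_coe, ← SchwartzMap.fourierInv_coe,
        FourierTransform.fourierInv_fourier_eq]
      have := hf (-n)
      rwa [Int.cast_neg, neg_div] at this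
    rw [Real.fourierInv_eq_fourier_neg, neg_neg] at h5
    rw [SchwartzMap.fourier_coe, h5, smul_zero]
  simp_rw [h2, zero_mul, tsum_zero, SchwartzMap.dilate_apply] at h1
  rw [← h1]
  congr 1
  funext k
  congr 1
  field_simp

namespace CatMap

/-! ### The space of quantum states -/

theorem translation_apply (h : ℝ) (ω : ℝ × ℝ) (u : 𝓢'(ℝ, ℂ)) (f : 𝓢(ℝ, ℂ)) :
    translation h ω u f = u (translationS h (-ω.1, ω.2) f) := rfl

theorem apply_compSubConst_of_mem_stateSpace {N : ℕ} {u : 𝓢'(ℝ, ℂ)} (hu : u ∈ stateSpace N)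
    (k : ℤ) (f : 𝓢(ℝ, ℂ)) : u (SchwartzMap.compSubConstCLM ℂ (k : ℝ) f) = u f := by
  have h1 := DFunLike.congr_fun (hu (-k) 0) f
  rw [translation_apply] at h1
  have h2 : translationS (planck N) (-((-k : ℤ) : ℝ), ((0 : ℤ) : ℝ)) f =
      SchwartzMap.compSubConstCLM ℂ (k : ℝ) f := by
    ext x
    rw [translationS_apply]
    simp
  rw [h2] at h1
  rw [h1]
  simp

/-- On the Fourier side, this invariance is periodicity with period `N`. -/
theorem apply_wave_smul_of_mem_stateSpace {N : ℕ} {u : 𝓢'(ℝ, ℂ)} (hu : u ∈ stateSpace N)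
    (k : ℤ) (f : 𝓢(ℝ, ℂ)) :
    u (SchwartzMap.smulLeftCLM ℂ (wave (2 * Real.pi * N * k)) f) = u f := by
  have h1 := DFunLike.congr_fun (hu 0 k) f
  rw [translation_apply] at h1
  have h2 : translationS (planck N) (-((0 : ℤ) : ℝ), (k : ℝ)) f =
      SchwartzMap.smulLeftCLM ℂ (wave (2 * Real.pi * N * k)) f := by
    ext x
    rw [translationS_apply, SchwartzMap.smulLeftCLM_apply_apply (wave_hasTemperateGrowth _)]
    simp only [wave, planck]
    simp only [Int.cast_zero, neg_zero, zero_mul, sub_zero, zero_div, div_inv_eq_mul, smul_eq_mul]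
    congr 4
    ring
  rw [h2] at h1
  rw [h1]
  simp

theorem fourierInv_compSubConst (g : 𝓢(ℝ, ℂ)) (a : ℝ) :
    𝓕⁻ (SchwartzMap.compSubConstCLM ℂ a g) =
      SchwartzMap.smulLeftCLM ℂ (wave (2 * Real.pi * a)) (𝓕⁻ g) := by
  ext x
  rw [SchwartzMap.smulLeftCLM_apply_apply (wave_hasTemperateGrowth _),
    SchwartzMap.fourierInv_coe, SchwartzMap.fourierInv_coe, Real.fourierInv_eq,
    Real.fourierInv_eq, ← integral_smul,
    ← integral_add_right_eq_self (fun v : ℝ => Real.fourierChar (inner ℝ v x) •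
      SchwartzMap.compSubConstCLM ℂ a g v) a]
  congr 1
  funext v
  simp only [SchwartzMap.compSubConstCLM_apply, add_sub_cancel_right, Circle.smul_def, wave,
    Real.fourierChar_apply, smul_eq_mul]
  rw [← mul_assoc, ← Complex.exp_add]
  congr 2
  simp
  ring

/-- Both periodicities are used. Period `1` in position replaces `f` by a `φ` that vanishes on `ℤ /
N`. Then `𝓕 φ` has zero periodization of period `N`, so the `N`-periodic distribution `𝓕⁻ u`
annihilates it. -/
theorem eq_zero_of_comb_eq_zero {N : ℕ} (hN : 0 < N) {u : 𝓢'(ℝ, ℂ)} (hu : u ∈ stateSpace N)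
    {f : 𝓢(ℝ, ℂ)} (hf : ∀ j : Fin N, comb ((j : ℝ) / N) f = 0) : u f = 0 := by
  have h0 : (N : ℝ) ≠ 0 := by exact_mod_cast hN.ne'
  obtain ⟨χ, φ, h1, h2⟩ := exists_eq_mul_periodization one_pos (v := u)
    (fun k f => by rw [Nat.cast_one, mul_one]; exact apply_compSubConst_of_mem_stateSpace hu k f) f
  have h3 : ∀ n : ℤ, φ ((n : ℝ) / N) = 0 := by
    intro n
    have hNz : (N : ℤ) ≠ 0 := by exact_mod_cast hN.ne'
    obtain ⟨j, hj⟩ : ∃ j : Fin N, ((j : ℕ) : ℤ) = n % N :=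
      ⟨⟨(n % N).toNat, by
        have := Int.emod_lt_of_pos n (b := N) (by omega)
        have := Int.emod_nonneg n hNz
        omega⟩,
        by have := Int.emod_nonneg n hNz; simp [this]⟩
    have h4 := hf j
    rw [comb_apply] at h4
    have h6 : ∑' k : ℤ, f ((n : ℝ) / N + k * (1 : ℕ)) = ∑' k : ℤ, f (k + (j : ℝ) / N) := by
      rw [← (Equiv.subRight (n / N)).tsum_eq]
      congr 1
      funext k
      congr 1
      have h7 : (n : ℝ) = (j : ℕ) + N * (n / N : ℤ) := by
        have := Int.emod_add_mul_ediv n N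
        rw [← hj] at this
        exact_mod_cast this.symm
      nth_rewrite 1 [h7]
      simp only [Equiv.subRight_apply]
      push_cast
      field_simp
      ring
    rw [h2, h6, h4, mul_zero]
  have h5 : (𝓕⁻ u) (𝓕 φ) = 0 := by
    refine eq_zero_of_periodization_eq_zero hN (fun k g => ?_) (tsum_fourier_eq_zero hN h3)
    rw [TemperedDistribution.fourierInv_apply, TemperedDistribution.fourierInv_apply,
      fourierInv_compSubConst]
    have h6 : 2 * Real.pi * ((k : ℝ) * N) = 2 * Real.pi * N * k := by ring
    rw [h6]
    exact apply_wave_smul_of_mem_stateSpace hu k (𝓕⁻ g)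
  rw [TemperedDistribution.fourierInv_apply, FourierTransform.fourierInv_fourier_eq] at h5
  rw [h1, h5]

/-- A functional that vanishes on the common kernel of finitely many functionals is a linear
combination of them. -/
theorem exists_hasCoordinates {N : ℕ} (hN : 0 < N) {u : 𝓢'(ℝ, ℂ)} (hu : u ∈ stateSpace N) :
    ∃ c : Fin N → ℂ, HasCoordinates N u c := by
  have h0 : (1 / √(N : ℝ) : ℂ) ≠ 0 := by
    have : 0 < √(N : ℝ) := Real.sqrt_pos.2 (by exact_mod_cast hN)
    simp only [ne_eq, one_div, inv_eq_zero, Complex.ofReal_eq_zero]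
    exact this.ne'
  have h1 := mem_span_of_iInf_ker_le_ker
    (L := fun j : Fin N => (PointwiseConvergenceCLM.coeLM ℂ _ _ (basisState N j)))
    (K := PointwiseConvergenceCLM.coeLM ℂ _ _ u) (fun f hf => by
      rw [Submodule.mem_iInf] at hf
      rw [LinearMap.mem_ker]
      refine eq_zero_of_comb_eq_zero hN hu fun j => ?_
      have h2 : (1 / √(N : ℝ) : ℂ) * comb ((j : ℝ) / N) f = 0 := hf j
      exact (mul_eq_zero.1 h2).resolve_left h0)
  obtain ⟨c, hc⟩ := (Submodule.mem_span_range_iff_exists_fun ℂ).1 h1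
  refine ⟨c, ?_⟩
  rw [HasCoordinates]
  ext f
  have h3 := LinearMap.congr_fun hc f
  simp_rw [← map_smul] at h3
  rw [← map_sum] at h3
  exact h3.symm

end CatMap

/-- Schur's lemma gives inner products only up to a constant `c`. Rescaling by `√‖c‖` makes `S` an
isometry, so unitarity on coordinates need not be proved. -/
theorem exists_eigenvector_of_inner_map_map {E : Type*} [NormedAddCommGroup E]
    [InnerProductSpace ℂ E] (S : E →ₗ[ℂ] E) {c κ : ℂ}
    (hS : ∀ x y, inner ℂ (S x) (S y) = c * inner ℂ x y) {n : ℕ} (hn : 0 < n)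
    (hSn : S ^ n = κ • 1) {e : E} (he : ‖e‖ = 1) :
    ∃ v : E, ∃ μ : ℂ, ‖v‖ = 1 ∧ S v = μ • v ∧ 1 / √n ≤ ‖inner ℂ e v‖ := by
  have hnorm : ∀ x, ‖S x‖ ^ 2 = ‖c‖ * ‖x‖ ^ 2 := by
    intro x
    have h1 := congrArg norm (hS x x)
    rw [inner_self_eq_norm_sq_to_K, inner_self_eq_norm_sq_to_K, norm_mul, norm_pow, norm_pow] at h1
    simpa using h1
  -- If `c = 0` then `S = 0`, and `e` itself is an eigenvector.
  rcases eq_or_ne c 0 with rfl | hc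
  · refine ⟨e, 0, he, ?_, ?_⟩
    · have h1 := hnorm e
      rw [norm_zero, zero_mul] at h1
      rw [zero_smul, ← norm_eq_zero]
      exact pow_eq_zero_iff two_ne_zero |>.1 h1
    · rw [inner_self_eq_norm_sq_to_K, he]
      simp only [Complex.coe_algebraMap, Complex.ofReal_one, one_pow, norm_one]
      refine div_le_one_of_le₀ ?_ (Real.sqrt_nonneg _)
      rw [Real.one_le_sqrt]
      exact_mod_cast hn
  · have hr : 0 < √‖c‖ := Real.sqrt_pos.2 (norm_pos_iff.2 hc)
    have hr0 : ((√‖c‖ : ℝ) : ℂ) ≠ 0 := by exact_mod_cast hr.ne'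
    obtain ⟨v, μ, h1, h2, h3⟩ := exists_eigenvector_of_pow_eq_smul_one
      (((√‖c‖ : ℝ) : ℂ)⁻¹ • S) (κ := ((√‖c‖ : ℝ) : ℂ)⁻¹ ^ n * κ) (fun x => by
        have h4 : ‖S x‖ = √‖c‖ * ‖x‖ := by
          rw [← Real.sqrt_sq (norm_nonneg (S x)), hnorm, Real.sqrt_mul (norm_nonneg _),
            Real.sqrt_sq (norm_nonneg _)]
        rw [LinearMap.smul_apply, norm_smul, norm_inv, Complex.norm_real, Real.norm_of_nonneg hr.le,
          h4, inv_mul_cancel_left₀ hr.ne']) hn (by rw [smul_pow, hSn, smul_smul]) he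
    refine ⟨v, √‖c‖ * μ, h1, ?_, h3⟩
    rw [mul_smul, ← h2, LinearMap.smul_apply, smul_smul, mul_inv_cancel₀ hr0, one_smul]

namespace CatMap

/-! ### The translations on the basis states -/

theorem planck_pos {N : ℕ} (hN : 0 < N) : 0 < planck N := by
  have : (0 : ℝ) < N := by exact_mod_cast hN
  unfold planck
  positivity

theorem translation_comb {N : ℕ} (hN : 0 < N) (m n : ℤ) (s : ℝ) :
    translation (planck N) ((m : ℝ) / N, (n : ℝ) / N) (comb s) =
      Complex.exp (Complex.I * (2 * Real.pi * n * s + Real.pi * m * n / N : ℝ)) •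
        comb (s + m / N) := by
  have h0 : (N : ℂ) ≠ 0 := by exact_mod_cast hN.ne'
  ext f
  rw [translation_apply, comb_apply]
  have h1 : (Complex.exp (Complex.I * (2 * Real.pi * n * s + Real.pi * m * n / N : ℝ)) •
      comb (s + m / N)) f = Complex.exp (Complex.I *
      (2 * Real.pi * n * s + Real.pi * m * n / N : ℝ)) * ∑' k : ℤ, f (k + (s + m / N)) := rfl
  rw [h1, ← tsum_mul_left]
  congr 1
  funext k
  rw [translationS_apply]
  congr 1
  · have h2 : Complex.I * ((n : ℝ) / N * (k + s) / planck N -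
        -((m : ℝ) / N) * (n / N) / (2 * planck N) : ℝ) =
        Complex.I * (2 * Real.pi * n * s + Real.pi * m * n / N : ℝ) +
          (n * k : ℤ) * (2 * Real.pi * Complex.I) := by
      unfold planck
      push_cast
      field_simp
      ring
    rw [h2, Complex.exp_add, Complex.exp_int_mul_two_pi_mul_I, mul_one]
  · congr 1
    ring

theorem comb_add_int (s : ℝ) (k : ℤ) : comb (s + k) = comb s := by
  ext f
  rw [comb_apply, comb_apply, ← (Equiv.addRight k).tsum_eq fun l : ℤ => f (l + s)]
  congr 1
  funext l
  congr 1
  simp only [Equiv.coe_addRight]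
  push_cast
  ring

/-- The residue of an integer modulo `N`. -/
def residue (N : ℕ) [NeZero N] (m : ℤ) : Fin N :=
  ⟨(m % N).toNat, by
    have h0 : (0 : ℤ) < N := by exact_mod_cast NeZero.pos N
    have := Int.emod_lt_of_pos m h0
    have := Int.emod_nonneg m h0.ne'
    omega⟩

theorem coe_residue {N : ℕ} [NeZero N] (m : ℤ) : ((residue N m : ℕ) : ℤ) = m % N := by
  have h0 : (N : ℤ) ≠ 0 := by exact_mod_cast NeZero.ne N
  have := Int.emod_nonneg m h0
  simp [residue, this]

theorem residue_coe {N : ℕ} [NeZero N] (j : Fin N) : residue N (j : ℕ) = j := by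
  have h1 := coe_residue (N := N) (j : ℕ)
  rw [Int.emod_eq_of_lt (by positivity) (by exact_mod_cast j.2)] at h1
  exact Fin.ext (by exact_mod_cast h1)

theorem residue_add_injective {N : ℕ} [NeZero N] (m : ℤ) :
    Function.Injective fun j : Fin N => residue N (j + m) := by
  intro i j h
  have h1 : ((residue N (i + m) : ℕ) : ℤ) = (residue N (j + m) : ℕ) := by
    have h' : residue N (i + m) = residue N (j + m) := h
    rw [h']
  rw [coe_residue, coe_residue] at h1
  have h2 : ((i : ℕ) : ℤ) ≡ (j : ℕ) [ZMOD N] := Int.ModEq.add_right_cancel' m h1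
  have h3 : ((i : ℕ) : ℤ) = (j : ℕ) := by
    have h4 := h2
    rwa [Int.ModEq, Int.emod_eq_of_lt (by positivity) (by exact_mod_cast i.2),
      Int.emod_eq_of_lt (by positivity) (by exact_mod_cast j.2)] at h4
  exact Fin.ext (by exact_mod_cast h3)

theorem basisState_residue {N : ℕ} [NeZero N] (m : ℤ) :
    basisState N (residue N m) = (1 / Real.sqrt N : ℂ) • comb ((m : ℝ) / N) := by
  have h0 : (N : ℝ) ≠ 0 := by exact_mod_cast NeZero.ne N
  rw [basisState]
  have h1 : (m : ℝ) = (residue N m : ℕ) + N * (m / N : ℤ) := by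
    have := Int.emod_add_mul_ediv m N
    rw [← coe_residue] at this
    exact_mod_cast this.symm
  have h2 : (m : ℝ) / N = (residue N m : ℕ) / N + (m / N : ℤ) := by
    nth_rewrite 1 [h1]
    field_simp
  rw [h2, comb_add_int]

/-- The phase factor of `U_(m/N, n/N)` on the basis vector `e_j`. -/
noncomputable def phase (N : ℕ) (m n j : ℤ) : ℂ :=
  Complex.exp (Complex.I * (2 * Real.pi * n * j / N + Real.pi * m * n / N : ℝ))

theorem norm_phase {N : ℕ} (m n j : ℤ) : ‖phase N m n j‖ = 1 := by
  rw [phase, mul_comm, Complex.norm_exp_ofReal_mul_I]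

theorem conj_phase_mul_phase {N : ℕ} (m n j : ℤ) :
    (starRingEnd ℂ) (phase N m n j) * phase N m n j = 1 := by
  rw [mul_comm, Complex.mul_conj', norm_phase]
  simp

/-- The modulus is `2N` rather than `N` because of the half phase `πmn / N`. This is why `A ^ n ≡ 1`
is needed modulo `2N`. -/
theorem phase_add_two_mul {N : ℕ} [NeZero N] (m n k l j : ℤ) :
    phase N (m + 2 * N * k) (n + 2 * N * l) j = phase N m n j := by
  have h0 : (N : ℂ) ≠ 0 := by exact_mod_cast NeZero.ne N
  have h1 : Complex.I * (2 * Real.pi * (n + 2 * N * l : ℤ) * j / N +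
      Real.pi * (m + 2 * N * k : ℤ) * (n + 2 * N * l : ℤ) / N : ℝ) =
      Complex.I * (2 * Real.pi * n * j / N + Real.pi * m * n / N : ℝ) +
      (2 * l * j + m * l + k * n + 2 * N * k * l : ℤ) * (2 * Real.pi * Complex.I) := by
    push_cast
    field_simp
    ring
  rw [phase, h1, Complex.exp_add, Complex.exp_int_mul_two_pi_mul_I, mul_one]
  rfl

theorem phase_zero_right {N : ℕ} (m j : ℤ) : phase N m 0 j = 1 := by
  simp [phase]

theorem phase_zero_one_injective {N : ℕ} [NeZero N] :
    Function.Injective fun j : Fin N => phase N 0 1 (j : ℕ) := by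
  intro i j h
  have h0 : (N : ℂ) ≠ 0 := by exact_mod_cast NeZero.ne N
  have e : ∀ j : Fin N, phase N 0 1 (j : ℕ) =
      Complex.exp (2 * Real.pi * Complex.I / N) ^ (j : ℕ) := by
    intro j
    rw [phase, ← Complex.exp_nat_mul]
    congr 1
    push_cast
    field_simp
    ring
  simp only [e] at h
  exact Fin.ext ((Complex.isPrimitiveRoot_exp N (NeZero.ne N)).pow_inj i.2 j.2 h)

theorem translation_basisState {N : ℕ} [NeZero N] (m n : ℤ) (j : Fin N) :
    translation (planck N) ((m : ℝ) / N, (n : ℝ) / N) (basisState N j) =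
      phase N m n (j : ℕ) • basisState N (residue N ((j : ℕ) + m)) := by
  have h1 : phase N m n (j : ℕ) =
      Complex.exp (Complex.I * (2 * Real.pi * n * ((j : ℕ) / N) + Real.pi * m * n / N : ℝ)) := by
    rw [phase]
    congr 3
    push_cast
    ring
  have h2 : (((j : ℕ) + m : ℤ) : ℝ) / N = (j : ℕ) / N + m / N := by
    push_cast
    ring
  rw [basisState_residue, basisState, map_smul, translation_comb (NeZero.pos N), h1, h2,
    smul_smul, smul_smul, mul_comm]

theorem basisState_mem_stateSpace {N : ℕ} [NeZero N] (j : Fin N) :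
    basisState N j ∈ stateSpace N := by
  intro y η
  have h0 : (N : ℝ) ≠ 0 := by exact_mod_cast NeZero.ne N
  have h1 := translation_comb (NeZero.pos N) (N * y) (N * η) ((j : ℕ) / N)
  have e : ∀ z : ℤ, ((N * z : ℤ) : ℝ) / N = z := by
    intro z
    push_cast
    field_simp
  simp only [e] at h1
  rw [basisState, map_smul, h1, comb_add_int, smul_comm]
  congr 1
  have h2 : Complex.I * (2 * Real.pi * (N * η : ℤ) * ((j : ℕ) / N : ℝ) +
      Real.pi * (N * y : ℤ) * (N * η : ℤ) / N : ℝ) =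
      N * Real.pi * Complex.I * (y * η : ℤ) + (η * (j : ℕ) : ℤ) * (2 * Real.pi * Complex.I) := by
    have : (N : ℂ) ≠ 0 := by exact_mod_cast NeZero.ne N
    push_cast
    field_simp
    ring
  rw [h2, Complex.exp_add, Complex.exp_int_mul_two_pi_mul_I, mul_one]

/-! ### Coordinates -/

/-- The state with a given coordinate vector. -/
noncomputable def ofCoordinates (N : ℕ) : EuclideanSpace ℂ (Fin N) →ₗ[ℂ] 𝓢'(ℝ, ℂ) :=
  Fintype.linearCombination ℂ (basisState N) ∘ₗ
    (WithLp.linearEquiv 2 ℂ (Fin N → ℂ)).toLinearMap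

theorem ofCoordinates_apply {N : ℕ} (v : EuclideanSpace ℂ (Fin N)) :
    ofCoordinates N v = ∑ j, v j • basisState N j := by
  simp [ofCoordinates, Fintype.linearCombination_apply]

theorem ofCoordinates_single {N : ℕ} (j : Fin N) :
    ofCoordinates N (EuclideanSpace.single j 1) = basisState N j := by
  rw [ofCoordinates_apply, Finset.sum_eq_single j]
  · simp
  · intro i _ hi
    rw [PiLp.single_apply, if_neg hi]
    exact zero_smul ℂ (basisState N i)
  · simp

/-- A bump of radius `1 / (2N)` about `j / N` meets no other point of `ℤ / N`. These test functions
separate the combs. -/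
theorem exists_comb_eq_ite {N : ℕ} [NeZero N] (j : Fin N) :
    ∃ f : 𝓢(ℝ, ℂ), ∀ i : Fin N, comb ((i : ℕ) / N) f = if i = j then 1 else 0 := by
  have hN : (0 : ℝ) < N := by exact_mod_cast NeZero.pos N
  let b : ContDiffBump (((j : ℕ) : ℝ) / N) :=
    ⟨1 / (4 * N), 1 / (2 * N), by positivity, by gcongr; norm_num⟩
  have hb : ContDiff ℝ (⊤ : ℕ∞) fun x => (b x : ℂ) := Complex.ofRealCLM.contDiff.comp b.contDiff
  have hc : HasCompactSupport fun x => (b x : ℂ) := b.hasCompactSupport.comp_left Complex.ofReal_zero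
  let B : 𝓢(ℝ, ℂ) := hc.toSchwartzMap hb
  have hB : ∀ x, B x = b x := fun x => rfl
  have hzero : ∀ (k : ℤ) (i : Fin N), (k ≠ 0 ∨ i ≠ j) → B (k + (i : ℕ) / N) = 0 := by
    intro k i h
    rw [hB, b.zero_of_le_dist, Complex.ofReal_zero]
    have h1 : (N * k + (i : ℕ) - (j : ℕ) : ℤ) ≠ 0 := by
      intro h2
      have h3 : ((i : ℕ) : ℤ) ≡ (j : ℕ) [ZMOD N] :=
        (Int.modEq_iff_dvd.2 ⟨k, by linarith⟩)
      have h4 : ((i : ℕ) : ℤ) = (j : ℕ) := by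
        rwa [Int.ModEq, Int.emod_eq_of_lt (by positivity) (by exact_mod_cast i.2),
          Int.emod_eq_of_lt (by positivity) (by exact_mod_cast j.2)] at h3
      have h5 : (N : ℤ) * k = 0 := by linarith
      have h6 : i = j := Fin.ext (by exact_mod_cast h4)
      have h7 : (N : ℤ) ≠ 0 := by exact_mod_cast NeZero.ne N
      exact h.elim (fun h => h ((mul_eq_zero.1 h5).resolve_left h7)) fun h => h h6
    have h2 : (1 : ℝ) ≤ |((N * k + (i : ℕ) - (j : ℕ) : ℤ) : ℝ)| := by
      exact_mod_cast Int.one_le_abs h1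
    have h3 : (k + (i : ℕ) / N - (j : ℕ) / N : ℝ) = ((N * k + (i : ℕ) - (j : ℕ) : ℤ) : ℝ) / N := by
      push_cast
      field_simp
    rw [Real.dist_eq, h3, abs_div, abs_of_pos hN]
    show 1 / (2 * (N : ℝ)) ≤ _
    gcongr
    linarith
  refine ⟨B, fun i => ?_⟩
  rw [comb_apply, tsum_eq_single 0 fun k hk => hzero k i (Or.inl hk)]
  split_ifs with h
  · rw [h, hB, b.one_of_mem_closedBall]
    · simp
    · simp only [Int.cast_zero, zero_add]
      exact Metric.mem_closedBall_self b.rIn_pos.le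
  · exact hzero 0 i (Or.inr h)

theorem ofCoordinates_injective {N : ℕ} [NeZero N] : Function.Injective (ofCoordinates N) := by
  refine (injective_iff_map_eq_zero _).2 fun v hv => ?_
  have h0 : (1 / √(N : ℝ) : ℂ) ≠ 0 := by
    have : 0 < √(N : ℝ) := Real.sqrt_pos.2 (by exact_mod_cast NeZero.pos N)
    simp only [ne_eq, one_div, inv_eq_zero, Complex.ofReal_eq_zero]
    exact this.ne'
  ext j
  obtain ⟨f, hf⟩ := exists_comb_eq_ite j
  have h1 : ∑ i, v i * ((1 / √(N : ℝ) : ℂ) * comb ((i : ℕ) / N) f) = 0 := by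
    have h2 := congrArg (PointwiseConvergenceCLM.evalCLM (RingHom.id ℂ) ℂ f) hv
    rw [ofCoordinates_apply, map_sum, map_zero] at h2
    exact h2
  simp only [hf, mul_ite, mul_one, mul_zero, Finset.sum_ite_eq', Finset.mem_univ, if_true] at h1
  exact (mul_eq_zero.1 h1).resolve_right h0

theorem ofCoordinates_mem_stateSpace {N : ℕ} [NeZero N] (v : EuclideanSpace ℂ (Fin N)) :
    ofCoordinates N v ∈ stateSpace N := by
  rw [ofCoordinates_apply]
  exact Submodule.sum_mem _ fun j _ => Submodule.smul_mem _ _ (basisState_mem_stateSpace j)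

theorem exists_ofCoordinates_eq {N : ℕ} [NeZero N] {u : 𝓢'(ℝ, ℂ)} (hu : u ∈ stateSpace N) :
    ∃ v, ofCoordinates N v = u := by
  obtain ⟨c, hc⟩ := exists_hasCoordinates (NeZero.pos N) hu
  exact ⟨WithLp.toLp 2 c, by rw [ofCoordinates_apply, hc]⟩

/-- The translation `U_(m/N, n/N)` in coordinates. -/
noncomputable def latticeTranslation (N : ℕ) [NeZero N] (m n : ℤ) :
    EuclideanSpace ℂ (Fin N) →ₗ[ℂ] EuclideanSpace ℂ (Fin N) :=
  (EuclideanSpace.basisFun (Fin N) ℂ).toBasis.constr ℂ fun j =>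
    phase N m n (j : ℕ) • EuclideanSpace.single (residue N ((j : ℕ) + m)) 1

theorem latticeTranslation_single {N : ℕ} [NeZero N] (m n : ℤ) (j : Fin N) :
    latticeTranslation N m n (EuclideanSpace.single j 1) =
      phase N m n (j : ℕ) • EuclideanSpace.single (residue N ((j : ℕ) + m)) 1 := by
  have h1 := (EuclideanSpace.basisFun (Fin N) ℂ).toBasis.constr_basis ℂ (fun j : Fin N =>
    phase N m n (j : ℕ) • EuclideanSpace.single (residue N ((j : ℕ) + m)) (1 : ℂ)) j
  rw [OrthonormalBasis.coe_toBasis, EuclideanSpace.basisFun_apply] at h1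
  exact h1

theorem linearMap_ext_single {N : ℕ} {F : Type*} [AddCommMonoid F] [Module ℂ F]
    {P Q : EuclideanSpace ℂ (Fin N) →ₗ[ℂ] F}
    (h : ∀ j, P (EuclideanSpace.single j 1) = Q (EuclideanSpace.single j 1)) : P = Q := by
  refine (EuclideanSpace.basisFun (Fin N) ℂ).toBasis.ext fun j => ?_
  rw [OrthonormalBasis.coe_toBasis, EuclideanSpace.basisFun_apply]
  exact h j

theorem inner_latticeTranslation {N : ℕ} [NeZero N] (m n : ℤ) (x y : EuclideanSpace ℂ (Fin N)) :
    inner ℂ (latticeTranslation N m n x) (latticeTranslation N m n y) = inner ℂ x y := by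
  have horth : Orthonormal ℂ
      (latticeTranslation N m n ∘ (EuclideanSpace.basisFun (Fin N) ℂ).toBasis) := by
    rw [orthonormal_iff_ite]
    intro i j
    simp only [Function.comp_apply, OrthonormalBasis.coe_toBasis, EuclideanSpace.basisFun_apply,
      latticeTranslation_single, inner_smul_left, inner_smul_right]
    rw [EuclideanSpace.inner_single_left]
    have h1 : residue N ((i : ℕ) + m) = residue N ((j : ℕ) + m) ↔ i = j :=
      (residue_add_injective m).eq_iff
    by_cases hij : i = j
    · subst hij
      simpa [mul_comm] using conj_phase_mul_phase (N := N) m n (i : ℕ)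
    · simp [hij, h1]
  have hb : Orthonormal ℂ (EuclideanSpace.basisFun (Fin N) ℂ).toBasis := by
    rw [OrthonormalBasis.coe_toBasis]
    exact (EuclideanSpace.basisFun (Fin N) ℂ).orthonormal
  exact ((latticeTranslation N m n).isometryOfOrthonormal hb horth).inner_map_map x y

theorem ofCoordinates_latticeTranslation {N : ℕ} [NeZero N]
    (m n : ℤ) (v : EuclideanSpace ℂ (Fin N)) :
    ofCoordinates N (latticeTranslation N m n v) =
      translation (planck N) ((m : ℝ) / N, (n : ℝ) / N) (ofCoordinates N v) := by
  have h1 : ofCoordinates N ∘ₗ latticeTranslation N m n =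
      (translation (planck N) ((m : ℝ) / N, (n : ℝ) / N)).toLinearMap ∘ₗ ofCoordinates N := by
    refine linearMap_ext_single fun j => ?_
    simp only [LinearMap.comp_apply, latticeTranslation_single, map_smul, ofCoordinates_single,
      ContinuousLinearMap.coe_coe, translation_basisState]
  exact LinearMap.congr_fun h1 v

theorem latticeTranslation_add_two_mul {N : ℕ} [NeZero N] (m n k l : ℤ) :
    latticeTranslation N (m + 2 * N * k) (n + 2 * N * l) = latticeTranslation N m n := by
  refine linearMap_ext_single fun j => ?_
  rw [latticeTranslation_single, latticeTranslation_single, phase_add_two_mul]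
  congr 2
  refine Fin.ext ?_
  have h1 := coe_residue (N := N) ((j : ℕ) + (m + 2 * N * k))
  have h2 := coe_residue (N := N) ((j : ℕ) + m)
  have h3 : ((j : ℕ) + (m + 2 * N * k) : ℤ) = (j : ℕ) + m + N * (2 * k) := by ring
  rw [h3, Int.add_mul_emod_self_left, ← h2] at h1
  rw [h3]
  exact_mod_cast h1

/-- Schur's lemma for the translations by lattice vectors. -/
theorem exists_inner_eq_mul_inner {N : ℕ} [NeZero N]
    {P Q : EuclideanSpace ℂ (Fin N) →ₗ[ℂ] EuclideanSpace ℂ (Fin N)}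
    (h : ∀ m n x y, inner ℂ (P (latticeTranslation N m n x)) (Q (latticeTranslation N m n y)) =
      inner ℂ (P x) (Q y)) :
    ∃ κ : ℂ, ∀ x y, inner ℂ (P x) (Q y) = κ * inner ℂ x y := by
  set δ : Fin N → EuclideanSpace ℂ (Fin N) := fun j => EuclideanSpace.single j 1 with hδ
  -- The basis vectors are eigenvectors of `U_(0, 1/N)` with distinct eigenvalues of modulus one, so
  -- invariance kills the off-diagonal entries.
  have hoff : ∀ i j, i ≠ j → inner ℂ (P (δ i)) (Q (δ j)) = 0 := by
    intro i j hij
    have h1 := h 0 1 (δ i) (δ j)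
    simp only [hδ, latticeTranslation_single, add_zero, residue_coe, map_smul, inner_smul_left,
      inner_smul_right] at h1
    by_contra hne
    rw [← mul_assoc, mul_eq_right₀ hne] at h1
    refine hij (phase_zero_one_injective ?_)
    have h2 := conj_phase_mul_phase (N := N) 0 1 (i : ℕ)
    have h3 : phase N 0 1 (i : ℕ) ≠ 0 := by
      rw [← norm_ne_zero_iff, norm_phase]
      exact one_ne_zero
    have h4 : (starRingEnd ℂ) (phase N 0 1 (i : ℕ)) ≠ 0 := (map_ne_zero _).2 h3
    exact mul_left_cancel₀ h4 (h2.trans ((mul_comm _ _).trans h1).symm)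
  -- `U_(j/N, 0)` carries `e_0` to `e_j`, so the diagonal entries agree.
  have hdiag : ∀ j, inner ℂ (P (δ j)) (Q (δ j)) = inner ℂ (P (δ 0)) (Q (δ 0)) := by
    intro j
    have h1 := h (j : ℕ) 0 (δ 0) (δ 0)
    simp only [hδ, latticeTranslation_single, phase_zero_right, one_smul] at h1
    have h2 : residue N (((0 : Fin N) : ℕ) + (j : ℕ)) = j := by
      simpa using residue_coe j
    rwa [h2] at h1
  refine ⟨inner ℂ (P (δ 0)) (Q (δ 0)), fun x y => ?_⟩
  have hadj : LinearMap.adjoint P ∘ₗ Q = (inner ℂ (P (δ 0)) (Q (δ 0)) : ℂ) • LinearMap.id := by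
    refine linearMap_ext_single fun j => ?_
    ext i
    have e : ∀ z : EuclideanSpace ℂ (Fin N), z i = inner ℂ (δ i) z := by
      intro z
      rw [hδ, EuclideanSpace.inner_single_left]
      simp
    rw [e, e, LinearMap.comp_apply, LinearMap.adjoint_inner_right, LinearMap.smul_apply,
      inner_smul_right, LinearMap.id_apply]
    by_cases hij : i = j
    · subst hij
      rw [hdiag i, hδ, EuclideanSpace.inner_single_left]
      simp
    · rw [hoff i j hij, hδ, EuclideanSpace.inner_single_left]
      simp [hij]
  rw [← LinearMap.adjoint_inner_right, ← LinearMap.comp_apply, hadj, LinearMap.smul_apply,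
    inner_smul_right, LinearMap.id_apply]

/-! ### The quantum cat map in coordinates -/

variable {A : Matrix.SpecialLinearGroup (Fin 2) ℤ} {M : L2 ≃ₗᵢ[ℂ] L2}
  {T : 𝓢'(ℝ, ℂ) →L[ℂ] 𝓢'(ℝ, ℂ)}

theorem act_map_div (A : Matrix.SpecialLinearGroup (Fin 2) ℤ) (m n : ℤ) (r : ℝ) :
    act (Matrix.SpecialLinearGroup.map (Int.castRingHom ℝ) A) ((m : ℝ) / r, (n : ℝ) / r) =
      (((A 0 0 * m + A 0 1 * n : ℤ) : ℝ) / r, ((A 1 0 * m + A 1 1 * n : ℤ) : ℝ) / r) := by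
  simp only [act, Matrix.SpecialLinearGroup.map_apply_coe, RingHom.mapMatrix_apply,
    Matrix.map_apply, eq_intCast]
  push_cast
  ext <;> simp only <;> ring

theorem IsQuantization.translation_comm {N : ℕ} [NeZero N] (hq : IsQuantization N A M T)
    (ω : ℝ × ℝ) (u : 𝓢'(ℝ, ℂ)) :
    T (translation (planck N) ω u) = translation (planck N)
      (act (Matrix.SpecialLinearGroup.map (Int.castRingHom ℝ) A) ω) (T u) :=
  CatMap.translation_comm (planck_pos (NeZero.pos N)) hq.metaplectic hq.extension ω u

/-- With `ab` and `cd` even, `A` preserves the form `yη` modulo `2` on `ℤ²`, hence the phases that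
define the space. -/
theorem IsQuantization.map_mem_stateSpace {N : ℕ} [NeZero N] (hq : IsQuantization N A M T)
    (hab : Even (A 0 0 * A 0 1)) (hcd : Even (A 1 0 * A 1 1)) {u : 𝓢'(ℝ, ℂ)}
    (hu : u ∈ stateSpace N) : T u ∈ stateSpace N := by
  intro y η
  have hdet := A.det_coe
  rw [Matrix.det_fin_two] at hdet
  -- The lattice vector is `A⁻¹ (y, η)`.
  have h1 := act_map_div A (A 1 1 * y - A 0 1 * η) (A 0 0 * η - A 1 0 * y) 1
  have e1 : A 0 0 * (A 1 1 * y - A 0 1 * η) + A 0 1 * (A 0 0 * η - A 1 0 * y) = y := by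
    linear_combination y * hdet
  have e2 : A 1 0 * (A 1 1 * y - A 0 1 * η) + A 1 1 * (A 0 0 * η - A 1 0 * y) = η := by
    linear_combination η * hdet
  rw [e1, e2] at h1
  simp only [div_one] at h1
  rw [← h1, ← hq.translation_comm, hu, map_smul]
  congr 1
  obtain ⟨r, hr⟩ := hab
  obtain ⟨s, hs⟩ := hcd
  have h2 : ((A 1 1 * y - A 0 1 * η) * (A 0 0 * η - A 1 0 * y) : ℤ) =
      y * η + 2 * (A 0 1 * A 1 0 * y * η - r * η ^ 2 - s * y ^ 2) := by
    linear_combination (y * η) * hdet - η ^ 2 * hr - y ^ 2 * hs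
  rw [h2]
  have h3 : (N * Real.pi * Complex.I *
      (y * η + 2 * (A 0 1 * A 1 0 * y * η - r * η ^ 2 - s * y ^ 2) : ℤ) : ℂ) =
      N * Real.pi * Complex.I * (y * η : ℤ) +
      (N * (A 0 1 * A 1 0 * y * η - r * η ^ 2 - s * y ^ 2) : ℤ) * (2 * Real.pi * Complex.I) := by
    push_cast
    ring
  rw [h3, Complex.exp_add, Complex.exp_int_mul_two_pi_mul_I, mul_one]

/-- The quantum cat map acts linearly on coordinate vectors. -/
theorem IsQuantization.exists_coordinate_map {N : ℕ} [NeZero N] (hq : IsQuantization N A M T)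
    (hab : Even (A 0 0 * A 0 1)) (hcd : Even (A 1 0 * A 1 1)) :
    ∃ S : EuclideanSpace ℂ (Fin N) →ₗ[ℂ] EuclideanSpace ℂ (Fin N),
      (∀ v, ofCoordinates N (S v) = T (ofCoordinates N v)) ∧
      ∀ m n v, S (latticeTranslation N m n v) =
        latticeTranslation N (A 0 0 * m + A 0 1 * n) (A 1 0 * m + A 1 1 * n) (S v) := by
  choose s hs using fun j : Fin N =>
    exists_ofCoordinates_eq (hq.map_mem_stateSpace hab hcd (basisState_mem_stateSpace j))
  set S := (EuclideanSpace.basisFun (Fin N) ℂ).toBasis.constr ℂ s with hS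
  have h1 : ofCoordinates N ∘ₗ S = T.toLinearMap ∘ₗ ofCoordinates N := by
    refine linearMap_ext_single fun j => ?_
    have h2 := (EuclideanSpace.basisFun (Fin N) ℂ).toBasis.constr_basis ℂ s j
    rw [OrthonormalBasis.coe_toBasis, EuclideanSpace.basisFun_apply] at h2
    rw [LinearMap.comp_apply, LinearMap.comp_apply, ofCoordinates_single, hS, h2, hs]
    rfl
  have h3 : ∀ v, ofCoordinates N (S v) = T (ofCoordinates N v) := LinearMap.congr_fun h1
  refine ⟨S, h3, fun m n v => ofCoordinates_injective ?_⟩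
  rw [h3, ofCoordinates_latticeTranslation, ofCoordinates_latticeTranslation, h3,
    hq.translation_comm, act_map_div]

/-- Schur's lemma enters twice: with `P = Q = S` it shows that `S` preserves inner products up to a
constant, and with `P = 1`, `Q = S ^ n` that `S ^ n` is a scalar, since `A ^ n` fixes lattice
vectors modulo `2N`. -/
theorem IsQuantization.exists_eigenfunction {N : ℕ} [NeZero N] (hq : IsQuantization N A M T)
    (hab : Even (A 0 0 * A 0 1)) (hcd : Even (A 1 0 * A 1 1)) {n : ℕ} (hn : 0 < n)
    {B : Matrix (Fin 2) (Fin 2) ℤ}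
    (hA : (A : Matrix (Fin 2) (Fin 2) ℤ) ^ n = 1 + ((2 * N : ℤ) : Matrix (Fin 2) (Fin 2) ℤ) * B) :
    ∃ u ∈ stateSpace N, u ≠ 0 ∧ (∃ μ : ℂ, T u = μ • u) ∧
      ∃ c : Fin N → ℂ, HasCoordinates N u c ∧ ‖WithLp.toLp 2 c‖ = 1 ∧
        1 / √n ≤ ‖WithLp.toLp ⊤ c‖ := by
  obtain ⟨S, hST, hSW⟩ := hq.exists_coordinate_map hab hcd
  obtain ⟨c, hc⟩ := exists_inner_eq_mul_inner (P := S) (Q := S) fun m n x y => by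
    rw [hSW, hSW, inner_latticeTranslation]
  have hpow : ∀ (l : ℕ) (w : Fin 2 → ℤ) (v : EuclideanSpace ℂ (Fin N)),
      (S ^ l) (latticeTranslation N (w 0) (w 1) v) =
        latticeTranslation N (((A : Matrix (Fin 2) (Fin 2) ℤ) ^ l).mulVec w 0)
          (((A : Matrix (Fin 2) (Fin 2) ℤ) ^ l).mulVec w 1) ((S ^ l) v) := by
    intro l
    induction l with
    | zero => simp
    | succ l ih =>
      intro w v
      rw [pow_succ', Module.End.mul_apply, ih, hSW, pow_succ', ← Matrix.mulVec_mulVec,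
        Module.End.mul_apply]
      congr 2 <;> simp [Matrix.mulVec, dotProduct, Fin.sum_univ_two]
  have hcomm : ∀ k l v, (S ^ n) (latticeTranslation N k l v) =
      latticeTranslation N k l ((S ^ n) v) := by
    intro k l v
    have h1 := hpow n ![k, l] v
    have h2 : ∀ i, ((A : Matrix (Fin 2) (Fin 2) ℤ) ^ n).mulVec ![k, l] i =
        ![k, l] i + 2 * N * B.mulVec ![k, l] i := by
      intro i
      rw [hA, Matrix.add_mulVec, Matrix.one_mulVec, ← zsmul_eq_mul, Matrix.smul_mulVec]
      rw [Pi.add_apply, Pi.smul_apply, smul_eq_mul]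
    rw [h2, h2, latticeTranslation_add_two_mul] at h1
    simpa using h1
  obtain ⟨κ, hκ⟩ := exists_inner_eq_mul_inner (P := LinearMap.id) (Q := S ^ n) fun k l x y => by
    rw [hcomm, LinearMap.id_apply, LinearMap.id_apply, inner_latticeTranslation]
  have hSn : S ^ n = κ • 1 := by
    refine LinearMap.ext fun y => ext_inner_left ℂ fun x => ?_
    rw [LinearMap.smul_apply, inner_smul_right, Module.End.one_apply, ← hκ, LinearMap.id_apply]
  obtain ⟨v, μ, h1, h2, h3⟩ := exists_eigenvector_of_inner_map_map S hc hn hSn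
    (e := EuclideanSpace.single (0 : Fin N) (1 : ℂ)) (by simp)
  have hv0 : v ≠ 0 := by
    rintro rfl
    simp at h1
  refine ⟨ofCoordinates N v, ofCoordinates_mem_stateSpace v, ?_, ⟨μ, ?_⟩, v.ofLp, ?_, h1, ?_⟩
  · exact fun h => hv0 (ofCoordinates_injective (h.trans (map_zero _).symm))
  · rw [← hST, h2, map_smul]
  · exact ofCoordinates_apply v
  -- The inner product with `e_0` is the coordinate of index `0`, bounded by the sup norm.
  · refine h3.trans ?_
    rw [EuclideanSpace.inner_single_left, map_one, one_mul]
    exact PiLp.norm_apply_le (WithLp.toLp ⊤ v.ofLp) 0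

/-! ### Eigenvalues of the matrix -/

theorem mem_realEigenvalues_iff (A : Matrix.SpecialLinearGroup (Fin 2) ℤ) (μ : ℝ) :
    μ ∈ realEigenvalues A ↔ μ ^ 2 - (A 0 0 + A 1 1 : ℤ) * μ + 1 = 0 := by
  have hdet := A.det_coe
  rw [Matrix.det_fin_two] at hdet
  have hdet' : (A 0 0 * A 1 1 - A 0 1 * A 1 0 : ℝ) = 1 := by exact_mod_cast hdet
  set B := (A : Matrix (Fin 2) (Fin 2) ℤ).map (Int.cast : ℤ → ℝ) with hB
  have h1 : μ ∈ realEigenvalues A ↔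
      ∃ v ≠ 0, (B - μ • (1 : Matrix (Fin 2) (Fin 2) ℝ)).mulVec v = 0 := by
    constructor
    · intro h
      obtain ⟨v, hv⟩ := Module.End.HasEigenvalue.exists_hasEigenvector h
      refine ⟨v, hv.2, ?_⟩
      have := hv.apply_eq_smul
      rw [Matrix.toLin'_apply] at this
      rw [Matrix.sub_mulVec, this, Matrix.smul_mulVec, Matrix.one_mulVec, sub_self]
    · rintro ⟨v, hv0, hv⟩
      refine Module.End.hasEigenvalue_of_hasEigenvector (x := v)
        (Module.End.hasEigenvector_iff.2 ⟨Module.End.mem_eigenspace_iff.2 ?_, hv0⟩)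
      rw [Matrix.sub_mulVec, Matrix.smul_mulVec, Matrix.one_mulVec, sub_eq_zero] at hv
      rw [Matrix.toLin'_apply, hv]
  rw [h1, Matrix.exists_mulVec_eq_zero_iff, Matrix.det_fin_two]
  have h2 : (B - μ • (1 : Matrix (Fin 2) (Fin 2) ℝ)) 0 0 *
      (B - μ • (1 : Matrix (Fin 2) (Fin 2) ℝ)) 1 1 -
      (B - μ • (1 : Matrix (Fin 2) (Fin 2) ℝ)) 0 1 *
      (B - μ • (1 : Matrix (Fin 2) (Fin 2) ℝ)) 1 0 =
      μ ^ 2 - (A 0 0 + A 1 1 : ℤ) * μ + 1 := by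
    simp only [hB, Matrix.sub_apply, Matrix.smul_apply, Matrix.map_apply, Matrix.one_apply,
      smul_eq_mul]
    simp only [Fin.isValue, if_true, if_false, one_ne_zero, zero_ne_one]
    push_cast
    linear_combination hdet'
  rw [h2]

/-- The eigenvalues are mutually inverse, so the largest is at least `1`; the value `1` would force
trace `2`. -/
theorem one_lt_of_isGreatest {A : Matrix.SpecialLinearGroup (Fin 2) ℤ}
    (hyperbolic : 2 < |A 0 0 + A 1 1|) {lam : ℝ} (hpos : 0 < lam)
    (largest : IsGreatest (realEigenvalues A) lam) : 1 < lam := by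
  have h1 := (mem_realEigenvalues_iff A lam).1 largest.1
  have h2 : lam⁻¹ ≤ lam := largest.2 ((mem_realEigenvalues_iff A _).2 (by
    field_simp
    linarith))
  have h3 : 1 ≤ lam := by
    by_contra! h
    have := (one_lt_inv₀ hpos).2 h
    linarith
  refine lt_of_le_of_ne h3 ?_
  rintro rfl
  have h4 : ((A 0 0 + A 1 1 : ℤ) : ℝ) = 2 := by linarith
  have h5 : A 0 0 + A 1 1 = 2 := by exact_mod_cast h4
  rw [h5] at hyperbolic
  norm_num at hyperbolic

/-- Cayley–Hamilton supplies the quadratic relation. -/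
theorem exists_pow_eq_one_add_lucasSeq (A : Matrix.SpecialLinearGroup (Fin 2) ℤ)
    (even_trace : Even (A 0 0 + A 1 1)) (n : ℕ) : ∃ B : Matrix (Fin 2) (Fin 2) ℤ,
      (A : Matrix (Fin 2) (Fin 2) ℤ) ^ (2 * (n + 1)) =
        1 + ((2 * lucasSeq (A 0 0 + A 1 1) (n + 1) : ℤ) : Matrix (Fin 2) (Fin 2) ℤ) * B := by
  have hdet := A.det_coe
  rw [Matrix.det_fin_two] at hdet
  obtain ⟨s, hs⟩ := even_trace
  rw [← two_mul] at hs
  have h1 : (A : Matrix (Fin 2) (Fin 2) ℤ) * A =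
      ((2 * s : ℤ) : Matrix (Fin 2) (Fin 2) ℤ) * A - 1 := by
    rw [← hs, ← zsmul_eq_mul]
    ext i j
    rw [Matrix.sub_apply, Matrix.smul_apply, Matrix.mul_apply, Fin.sum_univ_two, smul_eq_mul]
    fin_cases i <;> fin_cases j <;> simp
    · linear_combination -hdet
    · ring
    · ring
    · linear_combination -hdet
  rw [hs]
  exact ⟨_, pow_two_mul_eq_one_add_lucasSeq h1 n⟩

/-- The period is `4k + 2`, while `2L` is only known to be at least `4k`; the factor `1 - ε` absorbs
the excess `2` once `εk ≥ 1`. -/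
theorem div_sqrt_two_mul_le {k : ℕ} {ε L : ℝ} (hε : 0 < ε) (hε1 : ε < 1) (hk : 1 ≤ ε * k)
    (hL : 2 * k ≤ L) : (1 - ε) / √(2 * L) ≤ 1 / √((2 * (2 * k + 1) : ℕ) : ℝ) := by
  have hk0 : (0 : ℝ) < k := by
    by_contra! h
    nlinarith
  rw [div_le_div_iff₀ (Real.sqrt_pos.2 (by linarith)) (Real.sqrt_pos.2 (by positivity)), one_mul]
  refine Real.le_sqrt_of_sq_le ?_
  rw [mul_pow, Real.sq_sqrt (by positivity)]
  push_cast
  have h1 : (1 - ε) ^ 2 ≤ 1 - ε := by nlinarith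
  have h2 : (1 - ε) ^ 2 * (2 * (2 * k + 1)) ≤ (1 - ε) * (2 * (2 * (k : ℝ) + 1)) := by
    gcongr
  nlinarith

end CatMap

/-! ### Choice of `N_k` and the final estimate -/

theorem theorem1 (A : Matrix.SpecialLinearGroup (Fin 2) ℤ)
    (hyperbolic : 2 < |A 0 0 + A 1 1|)
    (even_ab : Even (A 0 0 * A 0 1)) (even_cd : Even (A 1 0 * A 1 1))
    (positive : ∀ μ ∈ CatMap.realEigenvalues A, 0 < μ)
    (even_trace : Even (A 0 0 + A 1 1))
    (coprime : IsCoprime (A 0 1) (A 1 0))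
    (lam : ℝ) (largest : IsGreatest (CatMap.realEigenvalues A) lam) :
    ∃ N : ℕ → ℕ, (∀ k, Odd (N k)) ∧ Filter.Tendsto N Filter.atTop Filter.atTop ∧
      ∀ ε : ℝ, 0 < ε → ∃ k₀ : ℕ, ∀ k ≥ k₀,
        ∀ (M : CatMap.L2 ≃ₗᵢ[ℂ] CatMap.L2) (T : 𝓢'(ℝ, ℂ) →L[ℂ] 𝓢'(ℝ, ℂ)),
          CatMap.IsQuantization (N k) A M T →
          ∃ u ∈ CatMap.stateSpace (N k), u ≠ 0 ∧ (∃ μ : ℂ, T u = μ • u) ∧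
            ∃ c : Fin (N k) → ℂ, CatMap.HasCoordinates (N k) u c ∧
              ‖WithLp.toLp 2 c‖ = 1 ∧
              (1 - ε) / Real.sqrt (2 * Real.logb lam (N k)) ≤ ‖WithLp.toLp ⊤ c‖ := by
  have hmem := (CatMap.mem_realEigenvalues_iff A lam).1 largest.1
  have hlam0 : 0 < lam := positive lam largest.1
  have hlam : 1 < lam := CatMap.one_lt_of_isGreatest hyperbolic hlam0 largest
  set t := A 0 0 + A 1 1 with ht
  have hcast : ∀ k : ℕ, (((lucasSeq t (2 * k + 1)).toNat : ℕ) : ℤ) = lucasSeq t (2 * k + 1) := by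
    intro k
    have h1 : (0 : ℝ) ≤ lucasSeq t (2 * k + 1) :=
      (pow_nonneg hlam0.le _).trans (pow_le_lucasSeq hlam0 hmem (2 * k))
    exact Int.toNat_of_nonneg (by exact_mod_cast h1)
  have hle : ∀ k : ℕ, lam ^ (2 * k) ≤ ((lucasSeq t (2 * k + 1)).toNat : ℝ) := by
    intro k
    have h1 := pow_le_lucasSeq hlam0 hmem (2 * k)
    rw [← hcast k] at h1
    exact_mod_cast h1
  have hpos : ∀ k : ℕ, 0 < (lucasSeq t (2 * k + 1)).toNat := by
    intro k
    have h1 : (0 : ℝ) < ((lucasSeq t (2 * k + 1)).toNat : ℝ) :=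
      (pow_pos hlam0 _).trans_le (hle k)
    exact_mod_cast h1
  -- Odd indices make the Lucas numbers odd for even trace; the period of the map is then twice the
  -- index.
  refine ⟨fun k => (lucasSeq t (2 * k + 1)).toNat, fun k => ?_, ?_, fun ε hε => ?_⟩
  · have h1 := odd_lucasSeq even_trace k
    rw [← hcast k] at h1
    exact_mod_cast h1
  · refine tendsto_natCast_atTop_iff (R := ℝ) |>.1 (Filter.tendsto_atTop_mono hle ?_)
    have h1 := tendsto_pow_atTop_atTop_of_one_lt (one_lt_pow₀ hlam two_ne_zero)
    simpa only [← pow_mul] using h1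
  -- `k₀ ≥ 1 / ε` gives the condition `1 ≤ ε * k` needed to absorb the excess in the period.
  · obtain ⟨k₀, hk₀⟩ := exists_nat_ge ε⁻¹
    refine ⟨k₀, fun k hk M T hq => ?_⟩
    have : NeZero (lucasSeq t (2 * k + 1)).toNat := ⟨(hpos k).ne'⟩
    obtain ⟨B, hB⟩ := CatMap.exists_pow_eq_one_add_lucasSeq A even_trace (2 * k)
    rw [← ht, ← hcast k] at hB
    obtain ⟨u, hu, hu0, hμ, c, hc, hc2, hctop⟩ :=
      hq.exists_eigenfunction even_ab even_cd (by omega) hB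
    refine ⟨u, hu, hu0, hμ, c, hc, hc2, ?_⟩
    -- For `ε ≥ 1` the claimed lower bound is not positive.
    rcases le_or_gt 1 ε with h1 | h1
    · exact (div_nonpos_of_nonpos_of_nonneg (by linarith) (Real.sqrt_nonneg _)).trans
        (norm_nonneg _)
    · refine (CatMap.div_sqrt_two_mul_le hε h1 (k := k) ?_ ?_).trans hctop
      · have h2 : ε⁻¹ ≤ k := hk₀.trans (by exact_mod_cast hk)
        rwa [inv_le_iff_one_le_mul₀' hε] at h2
      -- `N_k ≥ lam ^ (2k)` means `log_λ N_k ≥ 2k`.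
      · rw [Real.le_logb_iff_rpow_le hlam (by exact_mod_cast hpos k)]
        have h2 := hle k
        rw [← Real.rpow_natCast] at h2
        exact_mod_cast h2
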